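/- Let $\zeta\ge 2$ and $d$ be natural numbers, let $\mathbb{S}^{\zeta-1}\subset\mathbb{R}^\zeta$ be the unit sphere with its surface measure, and let $\mathbb{MS}(\zeta,d)=(\mathbb{S}^{\zeta-1})^d$ carry the uniform measure, i.e. the product of the surface measures; write $\mathbf{x}=(\mathbf{x}^{(1)},\dots,\mathbf{x}^{(d)})$ for its points, and $|\mathbb{S}^{\zeta-2}|$ for the area of $\mathbb{S}^{\zeta-2}$ ($|\mathbb{S}^0|=2$). For each $k\ge 0$ let $Y_{k1},\dots,Y_{kN(\zeta,k)}$ be an orthonormal basis in $L^2(\mathbb{S}^{\zeta-1})$ of the space of spherical harmonics of frequency $k$, that is, of restrictions to $\mathbb{S}^{\zeta-1}$ of harmonic homogeneous polynomials of degree $k$; $N(\zeta,k)$ is the dimension of that space. For $\mathbf{k}\in\mathbb{N}^d$ and $\mathbf{j}$ with $j_i\in\{1,\dots,N(\zeta,k_i)\}$ define the SH-product $Y_{\mathbf{k},\mathbf{j}}(\mathbf{x})=\prod_{i=1}^d Y_{k_ij_i}(\mathbf{x}^{(i)})$. Let $w(t)=(1-t^2)^{(\zeta-3)/2}$ and let $Q_k$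 be the Gegenbauer polynomials given by $Q_0=1$, $Q_1=t$, $(k+\zeta-1)Q_{k+2}=(2k+\zeta)\,t\,Q_{k+1}-(k+1)Q_k$. Let $K:\mathbb{MS}(\zeta,d)\times\mathbb{MS}(\zeta,d)\to\mathbb{R}$ be a multi-dot product kernel, $K(\mathbf{x},\mathbf{z})=\kappa(\langle\mathbf{x}^{(1)},\mathbf{z}^{(1)}\rangle,\dots,\langle\mathbf{x}^{(d)},\mathbf{z}^{(d)}\rangle)$, where $\kappa(\mathbf{t})\prod_i w(t_i)$ is integrable on $[-1,1]^d$, and put $$\lambda_{\mathbf{k}}=|\mathbb{S}^{\zeta-2}|^d\int_{[-1,1]^d}\kappa(\mathbf{t})\prod_{i=1}^d Q_{k_i}(t_i)\,(1-t_i^2)^{\frac{\zeta-3}{2}}\,d\mathbf{t}.$$ Then: 1. $\deg Q_k=k$, $Q_k(1)=1$, and the $Q_k$ are orthogonal on $[-1,1]$ with respect to the weight $w$. 2. The SH-products form a complete orthonormal system in $L^2(\mathbb{MS}(\zeta,d))$. 3. Every SH-product is an eigenfunction of $K$, with an eigenvalue that depends only on the frequency vector $\mathbf{k}$: for every $\mathbf{x}$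 the function $\mathbf{z}\mapsto K(\mathbf{x},\mathbf{z})Y_{\mathbf{k},\mathbf{j}}(\mathbf{z})$ is integrable and $\int K(\mathbf{x},\mathbf{z})Y_{\mathbf{k},\mathbf{j}}(\mathbf{z})\,d\mathbf{z}=\lambda_{\mathbf{k}}Y_{\mathbf{k},\mathbf{j}}(\mathbf{x})$. 4. There are no others: if $0\ne f\in L^2(\mathbb{MS}(\zeta,d))$ and $\int K(\mathbf{x},\mathbf{z})f(\mathbf{z})\,d\mathbf{z}=\mu f(\mathbf{x})$ for almost every $\mathbf{x}$, then $\mu=\lambda_{\mathbf{k}}$ for some $\mathbf{k}$, and $f$ is orthogonal to every $Y_{\mathbf{k},\mathbf{j}}$ with $\lambda_{\mathbf{k}}\neq\mu$. 5. If moreover $\kappa(\mathbf{t})^2\prod_i w(t_i)$ is integrable on $[-1,1]^d$, then $K$ is in $L^2(\mathbb{MS}(\zeta,d)\times\mathbb{MS}(\zeta,d))$ and $$K(\mathbf{x},\mathbf{z})=\sum_{\mathbf{k},\mathbf{j}}\lambda_{\mathbf{k}}Y_{\mathbf{k},\mathbf{j}}(\mathbf{x})Y_{\mathbf{k},\mathbf{j}}(\mathbf{z})$$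 with unconditional convergence in that space. 6. If $\kappa$ is continuous on $[-1,1]^d$ and $K$ is symmetric positive semidefinite, or if $\kappa$ is the sum of a power series $\sum_{\mathbf{n}\ge 0}b_{\mathbf{n}}\mathbf{t}^{\mathbf{n}}$ with real coefficients that converges unconditionally at every point of $[-1,1]^d$, then this decomposition converges unconditionally and uniformly on $\mathbb{MS}(\zeta,d)\times\mathbb{MS}(\zeta,d)$ (in particular at every point). -/

import Mathlib

open MeasureTheory

noncomputable section

namespace MultiDot

/-- The unit sphere `S^{n-1}` of `ℝ^n` (Euclidean norm). -/
abbrev Sph (n : ℕ) : Type := Metric.sphere (0 : EuclideanSpace ℝ (Fin n)) 1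

/-- The surface measure on `S^{n-1}`. -/
def surf (n : ℕ) : Measure (Sph n) :=
  (volume : Measure (EuclideanSpace ℝ (Fin n))).toSphere

/-- The surface area `|S^{n-1}|` of the unit sphere of `ℝ^n`. -/
def area (n : ℕ) : ℝ := (surf n).real Set.univ

/-- The multisphere `MS(ζ, d) = S^{ζ-1} × ⋯ × S^{ζ-1}` (`d` factors). -/
abbrev MS (ζ d : ℕ) : Type := Fin d → Sph ζ

/-- The uniform measure on the multisphere: the product of the surface measures. -/
def unif (ζ d : ℕ) : Measure (MS ζ d) :=
  haveI : IsFiniteMeasure (surf ζ) :=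
    inferInstanceAs (IsFiniteMeasure (volume : Measure (EuclideanSpace ℝ (Fin ζ))).toSphere)
  Measure.pi fun _ => surf ζ

/-- The vector `t = (⟨x⁽¹⁾, z⁽¹⁾⟩, …, ⟨x⁽ᵈ⁾, z⁽ᵈ⁾⟩)` of pixelwise dot products. -/
def dots {ζ d : ℕ} (x z : MS ζ d) : Fin d → ℝ :=
  fun i => inner ℝ (x i : EuclideanSpace ℝ (Fin ζ)) (z i : EuclideanSpace ℝ (Fin ζ))

/-- The cube `[-1, 1]^d`. -/
def cube (d : ℕ) : Set (Fin d → ℝ) := Set.Icc (fun _ => -1) (fun _ => 1)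

/-- `K` is the multi-dot product kernel with profile `κ`; only the values of `κ` on the cube
matter. -/
def IsMultiDot {ζ d : ℕ} (K : MS ζ d → MS ζ d → ℝ) (κ : (Fin d → ℝ) → ℝ) : Prop :=
  ∀ x z, K x z = κ (dots x z)

/-! ### Spherical harmonics -/

/-- The Laplacian on polynomials in `n` variables. -/
def polyLaplacian (n : ℕ) : MvPolynomial (Fin n) ℝ →ₗ[ℝ] MvPolynomial (Fin n) ℝ :=
  ∑ i : Fin n, (MvPolynomial.pderiv i).toLinearMap ∘ₗ (MvPolynomial.pderiv i).toLinearMap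

/-- Restriction of polynomials to the unit sphere. -/
def restrictSph (n : ℕ) : MvPolynomial (Fin n) ℝ →ₗ[ℝ] (Sph n → ℝ) where
  toFun p := fun x => MvPolynomial.eval (fun i => (x : EuclideanSpace ℝ (Fin n)) i) p
  map_add' p q := by ext x; simp
  map_smul' c p := by ext x; simp [MvPolynomial.smul_eval]

/-- The space of spherical harmonics of frequency `k` on `S^{n-1}`: restrictions to the sphere of
the harmonic homogeneous polynomials of degree `k`. -/
def sphHarm (n k : ℕ) : Submodule ℝ (Sph n → ℝ) :=
  (MvPolynomial.homogeneousSubmodule (Fin n) ℝ k ⊓ LinearMap.ker (polyLaplacian n)).map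
    (restrictSph n)

/-- The number `N(n, k)` of spherical harmonics of frequency `k` on `S^{n-1}`. -/
def numHarm (n k : ℕ) : ℕ := Module.finrank ℝ (sphHarm n k)

/-- For each frequency `k`, the functions `Y k j`, `j ∈ [N(n, k)]`, are an orthonormal basis of the
spherical harmonics of frequency `k` (they are orthonormal, and as many as the dimension). -/
structure IsSHBasis (n : ℕ) (Y : (k : ℕ) → Fin (numHarm n k) → Sph n → ℝ) : Prop where
  mem : ∀ k j, Y k j ∈ sphHarm n k
  orthonormal : ∀ k j j', ∫ x, Y k j x * Y k j' x ∂(surf n) = if j = j' then 1 else 0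

/-- The index set of the SH-products: frequency vectors `k ∈ ℕ^d` with phases
`j_i ∈ [N(ζ, k_i)]`. -/
abbrev SHIndex (ζ d : ℕ) : Type := (k : Fin d → ℕ) × ((i : Fin d) → Fin (numHarm ζ (k i)))

/-- The SH-product `Y_{k,j}(x) = ∏ i, Y_{k_i j_i}(x⁽ⁱ⁾)`. -/
def shProd {ζ d : ℕ} (Y : (k : ℕ) → Fin (numHarm ζ k) → Sph ζ → ℝ) (p : SHIndex ζ d)
    (x : MS ζ d) : ℝ :=
  ∏ i, Y (p.1 i) (p.2 i) (x i)

/-! ### Gegenbauer polynomials and eigenvalues -/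

/-- The Gegenbauer polynomials `Q_k` of dimension `n`, normalized by `Q_k(1) = 1`, through the
recurrence `(k + n - 1) Q_{k+2} = (2k + n) t Q_{k+1} - (k + 1) Q_k`. -/
def gegenbauer (n : ℕ) : ℕ → Polynomial ℝ
  | 0 => 1
  | 1 => Polynomial.X
  | k + 2 =>
      Polynomial.C (((k : ℝ) + n - 1)⁻¹) *
        (Polynomial.C (2 * (k : ℝ) + n) * Polynomial.X * gegenbauer n (k + 1)
          - Polynomial.C ((k : ℝ) + 1) * gegenbauer n k)

/-- The weight `(1 - t²)^{(n-3)/2}`. -/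
def weight (n : ℕ) (t : ℝ) : ℝ := (1 - t ^ 2) ^ (((n : ℝ) - 3) / 2)

/-- `λ_k = |S^{ζ-2}|^d ∫_{[-1,1]^d} κ(t) ∏ i, Q_{k_i}(t_i) (1 - t_i²)^{(ζ-3)/2} dt`. -/
def eigval (ζ : ℕ) {d : ℕ} (κ : (Fin d → ℝ) → ℝ) (k : Fin d → ℕ) : ℝ :=
  area (ζ - 1) ^ d *
    ∫ t in cube d, κ t * ∏ i, ((gegenbauer ζ (k i)).eval (t i) * weight ζ (t i))

/-- The nonzero function `f` is an eigenfunction, with eigenvalue `μ`, of the integral operator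
`f ↦ ∫ K(·, z) f(z) dz` with respect to the uniform measure on the multisphere. -/
def IsEigenfunction {ζ d : ℕ} (K : MS ζ d → MS ζ d → ℝ) (μ : ℝ) (f : MS ζ d → ℝ) : Prop :=
  f ≠ 0 ∧ ∀ x, Integrable (fun z => K x z * f z) (unif ζ d) ∧
    ∫ z, K x z * f z ∂(unif ζ d) = μ * f x

/-- `κ` is the sum of a power series that converges (unconditionally) on all of `[-1, 1]^d`. -/
def IsPowerSeriesOnCube {d : ℕ} (κ : (Fin d → ℝ) → ℝ) : Prop :=
  ∃ b : (Fin d → ℕ) → ℝ, ∀ t ∈ cube d, HasSum (fun n => b n * ∏ i, t i ^ n i) (κ t)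

end MultiDot

end

/-!
For `q` homogeneous of degree `m`, integrating `∂ᵢ q` against a Gaussian in polar coordinates gives
`∫ ∂ᵢ q = (m + n - 1) ∫ xᵢ q` on the sphere `S^{n-1}`. Repeating this lowers the degree of
`∫ ⟨x, ·⟩ᵐ h` for a solid harmonic `h` until it becomes a multiple of `h(x)`, with a constant that
depends only on `m` and on the degree `k` of `h`. The zonal harmonic `z ↦ Q_k(⟨x, z⟩)` determines
the constant; as the distribution of `⟨x, ·⟩` on the sphere has density `|S^{n-2}| w`, this is the
Funk–Hecke formula `∫ φ(⟨x, z⟩) Y(z) dz = λ_k Y(x)` for polynomials `φ`. On the multisphere it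
holds for products and hence, by density of polynomials in `L¹`, for every integrable `κ`.

SH-products are complete because every polynomial restricts to the sphere as a sum of spherical
harmonics. Applying the operator of `K` to a test function and taking coefficients shows that there
are no other eigenvalues; Parseval's identity for the sections `K(x, ·)` gives the decomposition in
`L²`.

By the addition theorem `∑ⱼ Y_{k,j}(x)²` is a constant `sumSq n k`, so the decomposition converges
uniformly as soon as `∑ |λ_k| sumSq n k` is finite. For a continuous positive semidefinite kernel
this sum is at most `K(x, x)`. Monomials `∏ tᵢ ^ mᵢ` give positive semidefinite kernels by Schur's
product theorem, with diagonal `1`, so for a power series the sum is at most `∑ |b_m|`, which is the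
absolute convergence at `t = (1, …, 1)`.
-/

noncomputable section

namespace MultiDot

/-! ### Polar coordinates -/

section Polar

open Set Real Module
open scoped ENNReal

theorem lintegral_volumeIoiPow (n : ℕ) (g : ℝ → ℝ≥0∞) :
    ∫⁻ r, g r ∂(Measure.volumeIoiPow n) = ∫⁻ r in Ioi (0 : ℝ), ENNReal.ofReal (r ^ n) * g r := by
  rw [Measure.volumeIoiPow, lintegral_withDensity_eq_lintegral_mul_non_measurable _ (by fun_prop)
    (by simp)]
  exact lintegral_subtype_comap measurableSet_Ioi fun r => ENNReal.ofReal (r ^ n) * g r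

theorem integral_volumeIoiPow (n : ℕ) (g : ℝ → ℝ) :
    ∫ r, g r ∂(Measure.volumeIoiPow n) = ∫ r in Ioi (0 : ℝ), r ^ n * g r := by
  rw [Measure.volumeIoiPow, integral_withDensity_eq_integral_toReal_smul (by fun_prop) (by simp),
    ← integral_subtype_comap measurableSet_Ioi fun r => r ^ n * g r]
  refine integral_congr_ae (.of_forall fun r => ?_)
  simp only [ENNReal.toReal_ofReal (pow_nonneg (mem_Ioi.1 r.2).le n), smul_eq_mul]

variable {E : Type*} [NormedAddCommGroup E] [NormedSpace ℝ E] [MeasurableSpace E] [BorelSpace E]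

theorem measurableEmbedding_smul_sphere :
    MeasurableEmbedding fun p : Metric.sphere (0 : E) 1 × Ioi (0 : ℝ) => (p.2 : ℝ) • (p.1 : E) :=
  (MeasurableEmbedding.subtype_coe (measurableSet_singleton (0 : E)).compl).comp
    (homeomorphUnitSphereProd E).symm.measurableEmbedding

variable [FiniteDimensional ℝ E] [Nontrivial E] (μ : Measure E) [μ.IsAddHaarMeasure]

theorem measurePreserving_smul_sphere :
    MeasurePreserving
      (fun p : Metric.sphere (0 : E) 1 × Ioi (0 : ℝ) => (p.2 : ℝ) • (p.1 : E))
      (μ.toSphere.prod (Measure.volumeIoiPow (finrank ℝ E - 1))) μ := by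
  have hsymm : MeasurePreserving (homeomorphUnitSphereProd E).symm
      (μ.toSphere.prod (Measure.volumeIoiPow (finrank ℝ E - 1))) (μ.comap (↑)) :=
    μ.measurePreserving_homeomorphUnitSphereProd.symm
      (homeomorphUnitSphereProd E).toMeasurableEquiv
  have hcoe := measurePreserving_subtype_coe (μa := μ) (measurableSet_singleton (0 : E)).compl
  rw [restrict_compl_singleton] at hcoe
  exact hcoe.comp hsymm

theorem lintegral_eq_lintegral_toSphere_lintegral_Ioi {F : E → ℝ≥0∞} (hF : Measurable F) :
    ∫⁻ y, F y ∂μ = ∫⁻ σ, ∫⁻ r in Ioi (0 : ℝ), ENNReal.ofReal (r ^ (finrank ℝ E - 1)) *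
      F (r • (σ : E)) ∂volume ∂μ.toSphere := by
  rw [← (measurePreserving_smul_sphere μ).lintegral_comp hF,
    lintegral_prod _ (by fun_prop)]
  exact lintegral_congr fun σ => lintegral_volumeIoiPow _ fun r => F (r • (σ : E))

theorem lintegral_direction_mul_norm {G : E → ℝ≥0∞} (hG : Measurable G) {g : ℝ → ℝ≥0∞}
    (hg : Measurable g) :
    ∫⁻ y, G (‖y‖⁻¹ • y) * g ‖y‖ ∂μ =
      (∫⁻ σ, G σ ∂μ.toSphere) *
        ∫⁻ r in Ioi (0 : ℝ), ENNReal.ofReal (r ^ (finrank ℝ E - 1)) * g r := by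
  rw [lintegral_eq_lintegral_toSphere_lintegral_Ioi μ (by fun_prop),
    ← lintegral_mul_const _ (by fun_prop)]
  refine lintegral_congr fun σ => ?_
  rw [← lintegral_const_mul _ (by fun_prop)]
  refine setLIntegral_congr_fun measurableSet_Ioi fun r (hr : 0 < r) => ?_
  have hσ : ‖(σ : E)‖ = 1 := norm_eq_of_mem_sphere σ
  simp only [norm_smul, hσ, mul_one, norm_of_nonneg hr.le, inv_smul_smul₀ hr.ne']
  ring

theorem integral_homogeneous_mul_norm {f : E → ℝ} {m : ℕ}
    (hf : ∀ (r : ℝ) (y : E), f (r • y) = r ^ m * f y) (g : ℝ → ℝ) :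
    ∫ y, f y * g ‖y‖ ∂μ =
      (∫ σ, f σ ∂μ.toSphere) * ∫ r in Ioi (0 : ℝ), r ^ (m + (finrank ℝ E - 1)) * g r := by
  calc ∫ y, f y * g ‖y‖ ∂μ
      = ∫ p : Metric.sphere (0 : E) 1 × Ioi (0 : ℝ), f p.1 * ((p.2 : ℝ) ^ m * g p.2)
          ∂μ.toSphere.prod (Measure.volumeIoiPow (finrank ℝ E - 1)) := by
        rw [← (measurePreserving_smul_sphere μ).integral_comp measurableEmbedding_smul_sphere]
        refine integral_congr_ae (.of_forall fun p => ?_)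
        have hr : 0 < (p.2 : ℝ) := p.2.2
        have hσ : ‖(p.1 : E)‖ = 1 := norm_eq_of_mem_sphere p.1
        simp only [hf, norm_smul, hσ, mul_one, norm_of_nonneg hr.le]
        ring
    _ = (∫ σ, f σ ∂μ.toSphere) * ∫ r in Ioi (0 : ℝ), r ^ (m + (finrank ℝ E - 1)) * g r := by
        rw [integral_prod_mul (fun σ : Metric.sphere (0 : E) 1 => f σ)
          (fun r : Ioi (0 : ℝ) => (r : ℝ) ^ m * g r), integral_volumeIoiPow _ fun r => r ^ m * g r]
        congr with r
        ring

end Polar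

section HalfPlane

open Set Real
open scoped ENNReal

theorem lintegral_upperHalfPlane_eq_polar (F : ℝ × ℝ → ℝ≥0∞) :
    ∫⁻ p in univ ×ˢ Ioi 0, F p =
      ∫⁻ p in Ioi 0 ×ˢ Ioo 0 π, ENNReal.ofReal p.1 * F (p.1 * cos p.2, p.1 * sin p.2) := by
  have hsub : Ioi (0 : ℝ) ×ˢ Ioo 0 π ⊆ polarCoord.target :=
    prod_mono_right (Ioo_subset_Ioo_left (neg_nonpos.2 pi_pos.le))
  rw [← lintegral_indicator (MeasurableSet.univ.prod measurableSet_Ioi),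
    ← lintegral_comp_polarCoord_symm, ← inter_eq_self_of_subset_left hsub,
    ← setLIntegral_indicator (measurableSet_Ioi.prod measurableSet_Ioo)]
  refine setLIntegral_congr_fun polarCoord.open_target.measurableSet fun p hp => ?_
  obtain ⟨hr, hθ⟩ : 0 < p.1 ∧ p.2 ∈ Ioo (-π) π := hp
  by_cases hpos : 0 < p.2
  · have hsin : 0 < p.1 * sin p.2 := mul_pos hr (sin_pos_of_pos_of_lt_pi hpos hθ.2)
    simp [indicator, hr, hpos, hθ.2, pos_of_mul_pos_right hsin hr.le]
  · have hsin : sin p.2 ≤ 0 := sin_nonpos_of_nonpos_of_neg_pi_le (not_lt.1 hpos) hθ.1.le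
    simp [indicator, hpos, hsin, hr]

theorem sin_mul_weight_cos {m : ℕ} (hm : 1 ≤ m) {θ : ℝ} (hθ : θ ∈ Ioo 0 π) :
    sin θ * weight (m + 1) (cos θ) = sin θ ^ (m - 1) := by
  have hs : 0 < sin θ := sin_pos_of_mem_Ioo hθ
  calc sin θ * weight (m + 1) (cos θ)
      = sin θ ^ (1 : ℝ) * (sin θ ^ (2 : ℝ)) ^ (((m + 1 : ℕ) - 3 : ℝ) / 2) := by
        rw [weight, rpow_one, rpow_two, sin_sq]
    _ = sin θ ^ ((m - 1 : ℕ) : ℝ) := by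
        rw [← rpow_mul hs.le, ← rpow_add hs]
        push_cast [Nat.cast_sub hm]
        ring_nf
    _ = sin θ ^ (m - 1) := rpow_natCast _ _

theorem lintegral_sin_pow_mul_comp_cos {m : ℕ} (hm : 1 ≤ m) (φ : ℝ → ℝ≥0∞) :
    ∫⁻ θ in Ioo 0 π, ENNReal.ofReal (sin θ ^ (m - 1)) * φ (cos θ) =
      ∫⁻ t in Icc (-1) 1, ENNReal.ofReal (weight (m + 1) t) * φ t := by
  rw [← bijOn_cos.image_eq, lintegral_image_eq_lintegral_abs_deriv_mul measurableSet_Icc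
    (fun θ _ => (hasDerivAt_cos θ).hasDerivWithinAt) injOn_cos, ← setLIntegral_congr Ioo_ae_eq_Icc]
  refine setLIntegral_congr_fun measurableSet_Ioo fun θ hθ => ?_
  have hs : 0 < sin θ := sin_pos_of_mem_Ioo hθ
  simp only [abs_neg, abs_of_pos hs, ← sin_mul_weight_cos hm hθ, ENNReal.ofReal_mul hs.le,
    mul_assoc]

theorem lintegral_halfPlane_direction_mul_norm {m : ℕ} (hm : 1 ≤ m) {φ g : ℝ → ℝ≥0∞}
    (hφ : Measurable φ) (hg : Measurable g) :
    ∫⁻ s, ∫⁻ ρ in Ioi 0, ENNReal.ofReal (ρ ^ (m - 1)) *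
        (φ (s / √(s ^ 2 + ρ ^ 2)) * g √(s ^ 2 + ρ ^ 2)) =
      (∫⁻ r in Ioi 0, ENNReal.ofReal (r ^ m) * g r) *
        ∫⁻ t in Icc (-1) 1, ENNReal.ofReal (weight (m + 1) t) * φ t := by
  calc ∫⁻ s, ∫⁻ ρ in Ioi 0, ENNReal.ofReal (ρ ^ (m - 1)) *
        (φ (s / √(s ^ 2 + ρ ^ 2)) * g √(s ^ 2 + ρ ^ 2))
      = ∫⁻ p in univ ×ˢ Ioi 0, ENNReal.ofReal (p.2 ^ (m - 1)) *
          (φ (p.1 / √(p.1 ^ 2 + p.2 ^ 2)) * g √(p.1 ^ 2 + p.2 ^ 2)) := by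
        rw [Measure.volume_eq_prod, ← Measure.prod_restrict, lintegral_prod _ (by fun_prop),
          Measure.restrict_univ]
    _ = ∫⁻ p in Ioi 0 ×ˢ Ioo 0 π, (ENNReal.ofReal (p.1 ^ m) * g p.1) *
          (ENNReal.ofReal (sin p.2 ^ (m - 1)) * φ (cos p.2)) := by
        rw [lintegral_upperHalfPlane_eq_polar]
        refine setLIntegral_congr_fun (measurableSet_Ioi.prod measurableSet_Ioo) fun p hp => ?_
        have hr : 0 < p.1 := hp.1
        have hnorm : √((p.1 * cos p.2) ^ 2 + (p.1 * sin p.2) ^ 2) = p.1 := by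
          rw [mul_pow, mul_pow, ← mul_add, cos_sq_add_sin_sq, mul_one, sqrt_sq hr.le]
        have hpow : p.1 ^ m = p.1 * p.1 ^ (m - 1) := by rw [← pow_succ', Nat.sub_add_cancel hm]
        simp only [hnorm, mul_div_cancel_left₀ _ hr.ne']
        rw [mul_pow, hpow, ENNReal.ofReal_mul hr.le,
          ENNReal.ofReal_mul (pow_nonneg hr.le (m - 1))]
        ring
    _ = _ := by
        rw [Measure.volume_eq_prod, ← Measure.prod_restrict,
          lintegral_prod_mul (f := fun r => ENNReal.ofReal (r ^ m) * g r)
            (g := fun θ => ENNReal.ofReal (sin θ ^ (m - 1)) * φ (cos θ))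
            (by fun_prop) (by fun_prop),
          lintegral_sin_pow_mul_comp_cos hm]

theorem integral_pow_mul_exp_neg_sq (a : ℕ) :
    ∫ r in Ioi (0 : ℝ), r ^ a * exp (-r ^ 2) = 1 / 2 * Gamma ((a + 1) / 2) := by
  rw [← integral_rpow_mul_exp_neg_rpow two_pos (neg_one_lt_zero.trans_le a.cast_nonneg)]
  simp

theorem lintegral_pow_mul_exp_neg_sq (a : ℕ) :
    ∫⁻ r in Ioi (0 : ℝ), ENNReal.ofReal (r ^ a) * ENNReal.ofReal (exp (-r ^ 2)) =
      ENNReal.ofReal (1 / 2 * Gamma ((a + 1) / 2)) := by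
  have hint := integrableOn_rpow_mul_exp_neg_rpow
    (neg_one_lt_zero.trans_le (a.cast_nonneg : (0 : ℝ) ≤ a)) (two_pos (α := ℝ))
  simp only [rpow_natCast, rpow_two] at hint
  have hnonneg : ∀ᵐ r ∂volume.restrict (Ioi (0 : ℝ)), 0 ≤ r ^ a * exp (-r ^ 2) :=
    ae_restrict_of_forall_mem measurableSet_Ioi fun r (hr : 0 < r) => by positivity
  rw [← integral_pow_mul_exp_neg_sq, ofReal_integral_eq_lintegral_ofReal hint hnonneg]
  exact setLIntegral_congr_fun measurableSet_Ioi fun r (hr : 0 < r) =>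
    (ENNReal.ofReal_mul (pow_nonneg hr.le a)).symm

end HalfPlane

/-! ### The distribution of the dot products -/

section WithDensity

open Set

theorem integral_withDensity_ofReal {α : Type*} [MeasurableSpace α] {μ : Measure α} {q : α → ℝ}
    (hq : Measurable q) (hq0 : 0 ≤ᵐ[μ] q) (g : α → ℝ) :
    ∫ t, g t ∂μ.withDensity (fun t => ENNReal.ofReal (q t)) = ∫ t, g t * q t ∂μ := by
  rw [integral_withDensity_eq_integral_toReal_smul hq.ennreal_ofReal (by simp)]
  refine integral_congr_ae (hq0.mono fun t ht => ?_)
  simp only [ENNReal.toReal_ofReal ht, smul_eq_mul, mul_comm]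

theorem integrable_withDensity_ofReal_iff {α : Type*} [MeasurableSpace α] {μ : Measure α}
    {q : α → ℝ} (hq : Measurable q) (hq0 : 0 ≤ᵐ[μ] q) {g : α → ℝ} :
    Integrable g (μ.withDensity fun t => ENNReal.ofReal (q t)) ↔
      Integrable (fun t => g t * q t) μ := by
  rw [integrable_withDensity_iff_integrable_smul' hq.ennreal_ofReal (by simp)]
  refine integrable_congr (hq0.mono fun t ht => ?_)
  simp only [ENNReal.toReal_ofReal ht, smul_eq_mul, mul_comm]

theorem pi_withDensity_ofReal {ι : Type*} [Fintype ι] {α : ι → Type*}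
    [∀ i, MeasurableSpace (α i)] {μ : ∀ i, Measure (α i)} [∀ i, SigmaFinite (μ i)]
    {q : ∀ i, α i → ℝ} (hq : ∀ i, Integrable (q i) (μ i)) (hq0 : ∀ i, 0 ≤ᵐ[μ i] q i) :
    Measure.pi (fun i => (μ i).withDensity fun t => ENNReal.ofReal (q i t)) =
      (Measure.pi μ).withDensity fun t => ENNReal.ofReal (∏ i, q i (t i)) := by
  have : ∀ i, IsFiniteMeasure ((μ i).withDensity fun t => ENNReal.ofReal (q i t)) :=
    fun i => isFiniteMeasure_withDensity_ofReal (hq i).2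
  refine Measure.pi_eq fun s hs => ?_
  have hprod : 0 ≤ᵐ[Measure.pi fun i => (μ i).restrict (s i)] fun t => ∏ i, q i (t i) := by
    filter_upwards [Filter.eventually_all.2 fun i =>
      Measure.tendsto_eval_ae_ae.eventually (ae_restrict_of_ae (s := s i) (hq0 i))] with t ht
    exact Finset.prod_nonneg fun i _ => ht i
  calc (Measure.pi μ).withDensity (fun t => ENNReal.ofReal (∏ i, q i (t i))) (univ.pi s)
      = ∫⁻ t, ENNReal.ofReal (∏ i, q i (t i)) ∂Measure.pi fun i => (μ i).restrict (s i) := by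
        rw [withDensity_apply _ (.univ_pi hs), Measure.restrict_pi_pi]
    _ = ENNReal.ofReal (∏ i, ∫ t in s i, q i t ∂μ i) := by
        rw [← ofReal_integral_eq_lintegral_ofReal
          (Integrable.fintype_prod_dep fun i => (hq i).restrict) hprod,
          integral_fintype_prod_eq_prod]
    _ = ∏ i, (μ i).withDensity (fun t => ENNReal.ofReal (q i t)) (s i) := by
        rw [ENNReal.ofReal_prod_of_nonneg fun i _ =>
          integral_nonneg_of_ae (ae_restrict_of_ae (hq0 i))]
        refine Finset.prod_congr rfl fun i _ => ?_
        rw [withDensity_apply _ (hs i), ofReal_integral_eq_lintegral_ofReal (hq i).restrict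
          (ae_restrict_of_ae (hq0 i))]

end WithDensity

section Sphere

open Set Real Module
open scoped ENNReal

instance isFiniteMeasure_surf (n : ℕ) : IsFiniteMeasure (surf n) :=
  inferInstanceAs (IsFiniteMeasure (volume : Measure (EuclideanSpace ℝ (Fin n))).toSphere)

instance isOpenPosMeasure_surf (n : ℕ) : (surf n).IsOpenPosMeasure :=
  inferInstanceAs ((volume : Measure (EuclideanSpace ℝ (Fin n))).toSphere.IsOpenPosMeasure)

theorem unif_eq_pi (ζ d : ℕ) : unif ζ d = Measure.pi fun _ : Fin d => surf ζ := rfl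

instance isFiniteMeasure_unif (ζ d : ℕ) : IsFiniteMeasure (unif ζ d) :=
  inferInstanceAs (IsFiniteMeasure (Measure.pi fun _ : Fin d => surf ζ))

instance isOpenPosMeasure_unif (ζ d : ℕ) : (unif ζ d).IsOpenPosMeasure :=
  Measure.pi.isOpenPosMeasure (fun _ : Fin d => surf ζ)

theorem surf_univ (n : ℕ) : surf n univ = ENNReal.ofReal (area n) :=
  (ofReal_measureReal).symm

theorem area_nonneg (n : ℕ) : 0 ≤ area n := measureReal_nonneg

theorem area_zero : area 0 = 0 := by
  simp [area, surf, measureReal_def]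

theorem area_pos {n : ℕ} (hn : 1 ≤ n) : 0 < area n := by
  have : Nonempty (Fin n) := ⟨⟨0, hn⟩⟩
  exact ENNReal.toReal_pos (Measure.measure_univ_ne_zero.2 (Measure.toSphere_ne_zero _))
    (measure_ne_top _ _)

theorem nonempty_sph {n : ℕ} (hn : 1 ≤ n) : Nonempty (Sph n) := by
  have : Nonempty (Fin n) := ⟨⟨0, hn⟩⟩
  exact (NormedSpace.sphere_nonempty.2 zero_le_one).to_subtype

theorem norm_toLp_cons {m : ℕ} (s : ℝ) (v : EuclideanSpace ℝ (Fin m)) :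
    ‖(WithLp.toLp 2 (Fin.cons s v.ofLp) : EuclideanSpace ℝ (Fin (m + 1)))‖ =
      √(s ^ 2 + ‖v‖ ^ 2) := by
  rw [EuclideanSpace.norm_eq, EuclideanSpace.norm_sq_eq, Fin.sum_univ_succ]
  simp

theorem lintegral_euclideanSpace_succ {m : ℕ} {F : EuclideanSpace ℝ (Fin (m + 1)) → ℝ≥0∞}
    (hF : Measurable F) :
    ∫⁻ u, F u = ∫⁻ s : ℝ, ∫⁻ v : EuclideanSpace ℝ (Fin m),
      F (WithLp.toLp 2 (Fin.cons s v.ofLp)) := by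
  rw [← (EuclideanSpace.volume_preserving_symm_measurableEquiv_toLp
      (Fin (m + 1))).symm.lintegral_comp hF,
    ← (volume_preserving_piFinSuccAbove (fun _ : Fin (m + 1) => ℝ) 0).symm.lintegral_comp
      (by fun_prop), Measure.volume_eq_prod, lintegral_prod _ (by fun_prop)]
  refine lintegral_congr fun s => ?_
  rw [← (EuclideanSpace.volume_preserving_symm_measurableEquiv_toLp (Fin m)).lintegral_comp
    (by fun_prop)]
  refine lintegral_congr fun v => congrArg F ?_
  ext i
  refine Fin.cases ?_ (fun i => ?_) i <;> simp [MeasurableEquiv.piFinSuccAbove]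

theorem lintegral_coord_div_norm_mul_norm {m : ℕ} (hm : 1 ≤ m) {φ g : ℝ → ℝ≥0∞}
    (hφ : Measurable φ) (hg : Measurable g) :
    ∫⁻ u : EuclideanSpace ℝ (Fin (m + 1)), φ (u 0 / ‖u‖) * g ‖u‖ =
      ENNReal.ofReal (area m) * ((∫⁻ r in Ioi 0, ENNReal.ofReal (r ^ m) * g r) *
        ∫⁻ t in Icc (-1) 1, ENNReal.ofReal (weight (m + 1) t) * φ t) := by
  have : Nonempty (Fin m) := ⟨⟨0, hm⟩⟩
  rw [lintegral_euclideanSpace_succ (by fun_prop),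
    ← lintegral_halfPlane_direction_mul_norm hm hφ hg,
    ← lintegral_const_mul' _ _ ENNReal.ofReal_ne_top]
  refine lintegral_congr fun s => ?_
  simp only [norm_toLp_cons, Fin.cons_zero]
  have hradial := lintegral_direction_mul_norm (volume : Measure (EuclideanSpace ℝ (Fin m)))
    measurable_one (g := fun ρ => φ (s / √(s ^ 2 + ρ ^ 2)) * g √(s ^ 2 + ρ ^ 2)) (by fun_prop)
  simp only [Pi.one_apply, one_mul, lintegral_one, finrank_euclideanSpace_fin] at hradial
  rw [← surf_univ]
  exact hradial

theorem exists_orthonormalBasis_apply_eq {𝕜 E ι : Type*} [RCLike 𝕜] [NormedAddCommGroup E]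
    [InnerProductSpace 𝕜 E] [Fintype ι] [FiniteDimensional 𝕜 E] (hι : finrank 𝕜 E = Fintype.card ι)
    (i : ι) {x : E} (hx : ‖x‖ = 1) : ∃ b : OrthonormalBasis ι 𝕜 E, b i = x := by
  have hv : Orthonormal 𝕜 (Set.domRestrict {i} fun _ : ι => x) :=
    ⟨fun _ => hx, fun j k hjk => (hjk (Subsingleton.elim _ _)).elim⟩
  obtain ⟨b, hb⟩ := hv.exists_orthonormalBasis_extension_of_card_eq hι
  exact ⟨b, hb i rfl⟩

theorem lintegral_comp_inner_sphere {m : ℕ} (hm : 1 ≤ m) (x : Sph (m + 1)) {φ : ℝ → ℝ≥0∞}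
    (hφ : Measurable φ) :
    ∫⁻ z : Sph (m + 1), φ (inner ℝ x.1 z.1) ∂(surf (m + 1)) = ENNReal.ofReal (area m) *
      ∫⁻ t in Icc (-1) 1, ENNReal.ofReal (weight (m + 1) t) * φ t := by
  set g : ℝ → ℝ≥0∞ := fun r => ENNReal.ofReal (exp (-r ^ 2))
  have hg : Measurable g := by fun_prop
  set I := ∫⁻ r in Ioi (0 : ℝ), ENNReal.ofReal (r ^ m) * g r
  have hI : I = ENNReal.ofReal (1 / 2 * Gamma ((m + 1) / 2)) := lintegral_pow_mul_exp_neg_sq m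
  have hI0 : I ≠ 0 := by
    rw [hI, Ne, ENNReal.ofReal_eq_zero, not_le]
    positivity
  have hI' : I ≠ ⊤ := hI ▸ ENNReal.ofReal_ne_top
  obtain ⟨b, hb⟩ := exists_orthonormalBasis_apply_eq (𝕜 := ℝ) (ι := Fin (m + 1)) (by simp) 0
    (norm_eq_of_mem_sphere x)
  refine (ENNReal.mul_left_inj hI0 hI').1 ?_
  calc (∫⁻ z : Sph (m + 1), φ (inner ℝ x.1 z.1) ∂(surf (m + 1))) * I
      = ∫⁻ y : EuclideanSpace ℝ (Fin (m + 1)), φ (inner ℝ x.1 (‖y‖⁻¹ • y)) * g ‖y‖ := by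
        rw [lintegral_direction_mul_norm volume (G := fun y => φ (inner ℝ x.1 y)) (by fun_prop) hg,
          finrank_euclideanSpace_fin, Nat.add_sub_cancel]
        rfl
    _ = ∫⁻ u : EuclideanSpace ℝ (Fin (m + 1)), φ (u 0 / ‖u‖) * g ‖u‖ := by
        rw [← b.measurePreserving_repr.lintegral_comp (f := fun u => φ (u 0 / ‖u‖) * g ‖u‖)
          (by fun_prop)]
        refine lintegral_congr fun y => ?_
        rw [LinearIsometryEquiv.norm_map, OrthonormalBasis.repr_apply_apply, hb, inner_smul_right,
          inv_mul_eq_div]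
    _ = ENNReal.ofReal (area m) *
          (∫⁻ t in Icc (-1) 1, ENNReal.ofReal (weight (m + 1) t) * φ t) * I := by
        rw [lintegral_coord_div_norm_mul_norm hm hφ hg]
        ring

end Sphere

section CoordMeasure

open Set

theorem measurable_weight (n : ℕ) : Measurable (weight n) := by
  unfold weight; fun_prop

theorem weight_nonneg (n : ℕ) {t : ℝ} (ht : t ∈ Icc (-1 : ℝ) 1) : 0 ≤ weight n t :=
  Real.rpow_nonneg (by nlinarith [ht.1, ht.2]) _

/-- The distribution, under the surface measure of `S^{n-1}`, of the scalar product with a fixed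
point of the sphere: the weight `|S^{n-2}| (1 - t²)^{(n-3)/2}` on `[-1, 1]`. -/
def coordMeasure (n : ℕ) : Measure ℝ :=
  (volume.restrict (Icc (-1) 1)).withDensity fun t => ENNReal.ofReal (area (n - 1) * weight n t)

theorem measurable_coordDensity (n : ℕ) : Measurable fun t => area (n - 1) * weight n t :=
  (measurable_weight n).const_mul _

theorem coordDensity_nonneg (n : ℕ) :
    0 ≤ᵐ[volume.restrict (Icc (-1) 1)] fun t => area (n - 1) * weight n t :=
  ae_restrict_of_forall_mem measurableSet_Icc fun _ ht =>
    mul_nonneg (area_nonneg _) (weight_nonneg n ht)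

theorem map_inner_surf {n : ℕ} (hn : 2 ≤ n) (x : Sph n) :
    (surf n).map (fun z : Sph n => inner ℝ x.1 z.1) = coordMeasure n := by
  obtain ⟨m, rfl⟩ := Nat.exists_eq_add_of_le' (one_le_two.trans hn)
  refine Measure.ext_of_lintegral _ fun φ hφ => ?_
  rw [lintegral_map hφ (by fun_prop), lintegral_comp_inner_sphere (by omega) x hφ, coordMeasure,
    lintegral_withDensity_eq_lintegral_mul _ (measurable_coordDensity _).ennreal_ofReal hφ,
    ← lintegral_const_mul' _ _ ENNReal.ofReal_ne_top, Nat.add_sub_cancel]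
  refine lintegral_congr fun t => ?_
  rw [Pi.mul_apply, ENNReal.ofReal_mul (area_nonneg _), mul_assoc]

instance isFiniteMeasure_coordMeasure (n : ℕ) : IsFiniteMeasure (coordMeasure n) := by
  rcases lt_or_ge n 2 with hn | hn
  · have hn1 : n - 1 = 0 := by omega
    rw [coordMeasure, hn1, area_zero]
    simp only [zero_mul, ENNReal.ofReal_zero]
    exact isFiniteMeasure_withDensity (by simp)
  · obtain ⟨x⟩ := nonempty_sph (n := n) (by omega)
    rw [← map_inner_surf hn x]
    infer_instance

theorem integrableOn_coordDensity (n : ℕ) :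
    IntegrableOn (fun t => area (n - 1) * weight n t) (Icc (-1) 1) := by
  have h : Integrable (fun _ => (1 : ℝ)) (coordMeasure n) := integrable_const 1
  simpa only [IntegrableOn, coordMeasure, one_mul] using (integrable_withDensity_ofReal_iff
    (measurable_coordDensity n) (coordDensity_nonneg n)).1 h

theorem integral_coordMeasure (n : ℕ) (g : ℝ → ℝ) :
    ∫ t, g t ∂(coordMeasure n) = area (n - 1) * ∫ t in Icc (-1 : ℝ) 1, g t * weight n t := by
  rw [coordMeasure, integral_withDensity_ofReal (measurable_coordDensity n)
    (coordDensity_nonneg n), ← integral_const_mul]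
  simp only [mul_left_comm]

theorem integrable_coordMeasure_iff {n : ℕ} (hn : 2 ≤ n) {g : ℝ → ℝ} :
    Integrable g (coordMeasure n) ↔ IntegrableOn (fun t => g t * weight n t) (Icc (-1) 1) := by
  have ha : IsUnit (area (n - 1)) := isUnit_iff_ne_zero.2 (area_pos (by omega)).ne'
  rw [coordMeasure, integrable_withDensity_ofReal_iff (measurable_coordDensity n)
    (coordDensity_nonneg n), IntegrableOn,
    ← integrable_const_mul_iff ha fun t => g t * weight n t]
  simp only [mul_left_comm]

end CoordMeasure

section DotsMeasure

open Set

theorem cube_eq_pi (d : ℕ) : cube d = univ.pi fun _ => Icc (-1) 1 := (pi_univ_Icc _ _).symm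

theorem mem_cube {d : ℕ} {t : Fin d → ℝ} : t ∈ cube d ↔ ∀ i, t i ∈ Icc (-1 : ℝ) 1 := by
  simp only [cube_eq_pi, mem_univ_pi]

theorem measurableSet_cube (d : ℕ) : MeasurableSet (cube d) := measurableSet_Icc

theorem isCompact_cube (d : ℕ) : IsCompact (cube d) := isCompact_Icc

theorem dots_mem_cube {ζ d : ℕ} (x z : MS ζ d) : dots x z ∈ cube d :=
  mem_cube.2 fun i => abs_le.1 <| (abs_real_inner_le_norm _ _).trans_eq <| by
    rw [norm_eq_of_mem_sphere, norm_eq_of_mem_sphere, one_mul]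

theorem dots_comm {ζ d : ℕ} (x z : MS ζ d) : dots x z = dots z x :=
  funext fun _ => real_inner_comm _ _

theorem continuous_dots {ζ d : ℕ} : Continuous fun w : MS ζ d × MS ζ d => dots w.1 w.2 := by
  unfold dots
  fun_prop

theorem measurable_dots {ζ d : ℕ} (x : MS ζ d) : Measurable (dots x) :=
  (continuous_dots.comp (.prodMk_right x)).measurable

/-- The distribution, under the uniform measure on the multisphere, of the vector of dot products
with a fixed point. -/
def dotsMeasure (n d : ℕ) : Measure (Fin d → ℝ) := Measure.pi fun _ => coordMeasure n

instance isFiniteMeasure_dotsMeasure (n d : ℕ) : IsFiniteMeasure (dotsMeasure n d) :=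
  inferInstanceAs (IsFiniteMeasure (Measure.pi fun _ : Fin d => coordMeasure n))

theorem map_dots_unif {ζ : ℕ} (hζ : 2 ≤ ζ) {d : ℕ} (x : MS ζ d) :
    (unif ζ d).map (dots x) = dotsMeasure ζ d := by
  have hmap := fun i => map_inner_surf hζ (x i)
  have hpi := Measure.pi_map_pi (μ := fun _ : Fin d => surf ζ)
    (f := fun i z => inner ℝ (x i).1 z.1) (hμ := fun i => by rw [hmap i]; infer_instance)
    fun i => by fun_prop
  simp only [hmap] at hpi
  exact hpi

theorem measurable_dotsDensity (n d : ℕ) :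
    Measurable fun t : Fin d → ℝ => area (n - 1) ^ d * ∏ i, weight n (t i) :=
  (Finset.measurable_prod _ fun i _ =>
    (measurable_weight n).comp (measurable_pi_apply i)).const_mul _

theorem dotsDensity_nonneg (n d : ℕ) :
    0 ≤ᵐ[volume.restrict (cube d)] fun t => area (n - 1) ^ d * ∏ i, weight n (t i) :=
  ae_restrict_of_forall_mem (measurableSet_cube d) fun _ ht => mul_nonneg
    (pow_nonneg (area_nonneg _) _) (Finset.prod_nonneg fun i _ => weight_nonneg n (mem_cube.1 ht i))

theorem dotsMeasure_eq_withDensity (n d : ℕ) :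
    dotsMeasure n d = (volume.restrict (cube d)).withDensity fun t =>
      ENNReal.ofReal (area (n - 1) ^ d * ∏ i, weight n (t i)) := by
  simp only [dotsMeasure, coordMeasure]
  rw [pi_withDensity_ofReal (fun _ => integrableOn_coordDensity n) fun _ => coordDensity_nonneg n,
    ← Measure.restrict_pi_pi, ← volume_pi, ← cube_eq_pi]
  simp only [Finset.prod_mul_distrib, Finset.prod_const, Finset.card_univ, Fintype.card_fin]

theorem integral_dotsMeasure (n : ℕ) {d : ℕ} (g : (Fin d → ℝ) → ℝ) :
    ∫ t, g t ∂(dotsMeasure n d) =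
      area (n - 1) ^ d * ∫ t in cube d, g t * ∏ i, weight n (t i) := by
  rw [dotsMeasure_eq_withDensity, integral_withDensity_ofReal (measurable_dotsDensity n d)
    (dotsDensity_nonneg n d), ← integral_const_mul]
  simp only [mul_left_comm]

theorem integrable_dotsMeasure_iff {n : ℕ} (hn : 2 ≤ n) {d : ℕ} {g : (Fin d → ℝ) → ℝ} :
    Integrable g (dotsMeasure n d) ↔
      IntegrableOn (fun t => g t * ∏ i, weight n (t i)) (cube d) := by
  have ha : IsUnit (area (n - 1) ^ d) :=
    isUnit_iff_ne_zero.2 (pow_pos (area_pos (by omega)) _).ne'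
  rw [dotsMeasure_eq_withDensity, integrable_withDensity_ofReal_iff (measurable_dotsDensity n d)
    (dotsDensity_nonneg n d), IntegrableOn,
    ← integrable_const_mul_iff ha fun t => g t * ∏ i, weight n (t i)]
  simp only [mul_left_comm]

theorem ae_mem_cube (n d : ℕ) : ∀ᵐ t ∂(dotsMeasure n d), t ∈ cube d := by
  rw [dotsMeasure_eq_withDensity]
  exact (withDensity_absolutelyContinuous _ _).ae_le (ae_restrict_mem (measurableSet_cube d))

end DotsMeasure

/-! ### Integrals of polynomials over the sphere -/

section HomogeneousPolynomial

open MvPolynomial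

theorem eval_smul_of_isHomogeneous {σ R : Type*} [CommSemiring R] {m : ℕ} {p : MvPolynomial σ R}
    (hp : p.IsHomogeneous m) (r : R) (y : σ → R) : eval (r • y) p = r ^ m * eval y p := by
  rw [eval_eq, eval_eq, Finset.mul_sum]
  refine Finset.sum_congr rfl fun a ha => ?_
  have hdeg : ∑ i ∈ a.support, a i = m := by
    rw [← hp (mem_support_iff.1 ha), Finsupp.weight_apply, Finsupp.sum]
    simp
  simp only [Pi.smul_apply, smul_eq_mul, mul_pow, Finset.prod_mul_distrib]
  rw [Finset.prod_pow_eq_pow_sum, hdeg, mul_left_comm]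

theorem eq_C_of_isHomogeneous_zero {σ R : Type*} [CommSemiring R] {p : MvPolynomial σ R}
    (hp : p.IsHomogeneous 0) : p = C (coeff 0 p) :=
  totalDegree_eq_zero_iff_eq_C.1 ((totalDegree_zero_iff_isHomogeneous σ).2 hp)

end HomogeneousPolynomial

section SphereIntegral

open Set Real MvPolynomial

theorem integrable_of_continuous {α : Type*} [TopologicalSpace α] [CompactSpace α]
    [MeasurableSpace α] [OpensMeasurableSpace α] {μ : Measure α} [IsFiniteMeasureOnCompacts μ]
    {f : α → ℝ} (hf : Continuous f) : Integrable f μ :=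
  hf.integrable_of_hasCompactSupport (.of_compactSpace f)

variable {n : ℕ}

theorem restrictSph_apply (p : MvPolynomial (Fin n) ℝ) (x : Sph n) :
    restrictSph n p x = eval x.1.ofLp p := rfl

theorem restrictSph_mul_apply (p q : MvPolynomial (Fin n) ℝ) (x : Sph n) :
    restrictSph n (p * q) x = restrictSph n p x * restrictSph n q x :=
  map_mul (eval x.1.ofLp) p q

theorem continuous_restrictSph (p : MvPolynomial (Fin n) ℝ) : Continuous (restrictSph n p) :=
  (MvPolynomial.continuous_eval p).comp
    ((PiLp.continuous_ofLp 2 _).comp continuous_subtype_val)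

theorem integrable_restrictSph (p : MvPolynomial (Fin n) ℝ) :
    Integrable (restrictSph n p) (surf n) :=
  integrable_of_continuous (continuous_restrictSph p)

/-- The integral of a polynomial over the sphere, as a linear functional. -/
def sphInt (n : ℕ) : MvPolynomial (Fin n) ℝ →ₗ[ℝ] ℝ where
  toFun p := ∫ x, restrictSph n p x ∂(surf n)
  map_add' p q := by
    simp only [map_add, Pi.add_apply]
    exact integral_add (integrable_restrictSph p) (integrable_restrictSph q)
  map_smul' c p := by
    simp only [map_smul, Pi.smul_apply, RingHom.id_apply]
    exact integral_smul c _

theorem sphInt_apply (p : MvPolynomial (Fin n) ℝ) :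
    sphInt n p = ∫ x, restrictSph n p x ∂(surf n) := rfl

theorem sphInt_one : sphInt n 1 = area n := by
  simp [sphInt_apply, restrictSph_apply, area]

theorem integrable_eval_mul_exp_neg_sq (p : MvPolynomial (Fin n) ℝ) :
    Integrable fun y : EuclideanSpace ℝ (Fin n) => eval y.ofLp p * exp (-‖y‖ ^ 2) := by
  induction p using MvPolynomial.induction_on' with
  | add p q hp hq =>
    simp only [map_add, add_mul]
    exact hp.add hq
  | monomial a c =>
    have hprod : Integrable (fun y : Fin n → ℝ => ∏ i, (y i ^ a i * exp (-y i ^ 2))) := by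
      refine Integrable.fintype_prod (f := fun i t => t ^ a i * exp (-t ^ 2)) fun i => ?_
      simpa using integrable_rpow_mul_exp_neg_mul_sq one_pos
        (neg_one_lt_zero.trans_le (a i).cast_nonneg)
    refine (((EuclideanSpace.volume_preserving_symm_measurableEquiv_toLp
      (Fin n)).integrable_comp_emb (MeasurableEquiv.measurableEmbedding _)).2 hprod
      |>.const_mul c).congr (.of_forall fun y => ?_)
    simp only [Function.comp_apply, eval_monomial]
    rw [Finsupp.prod_fintype _ _ (by simp), Finset.prod_mul_distrib, ← Real.exp_sum,
      Finset.sum_neg_distrib, EuclideanSpace.norm_sq_eq]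
    simp [mul_assoc]

theorem integral_eval_mul_exp_neg_sq (hn : 1 ≤ n) {m : ℕ} {p : MvPolynomial (Fin n) ℝ}
    (hp : p.IsHomogeneous m) :
    ∫ y : EuclideanSpace ℝ (Fin n), eval y.ofLp p * exp (-‖y‖ ^ 2) =
      sphInt n p * (1 / 2 * Gamma ((m + n) / 2)) := by
  have : Nonempty (Fin n) := ⟨⟨0, hn⟩⟩
  have hcast : ((m + (n - 1) : ℕ) + 1 : ℝ) = m + n := by
    push_cast [Nat.cast_sub hn]
    ring
  have hpolar := integral_homogeneous_mul_norm (volume : Measure (EuclideanSpace ℝ (Fin n)))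
    (f := fun y => eval y.ofLp p) (fun r y => eval_smul_of_isHomogeneous hp r y.ofLp)
    fun r => exp (-r ^ 2)
  rwa [finrank_euclideanSpace_fin, integral_pow_mul_exp_neg_sq, hcast] at hpolar

theorem hasFDerivAt_eval (p : MvPolynomial (Fin n) ℝ) (y : EuclideanSpace ℝ (Fin n)) :
    HasFDerivAt (fun y : EuclideanSpace ℝ (Fin n) => eval y.ofLp p)
      (∑ i, eval y.ofLp (pderiv i p) • (EuclideanSpace.proj i : EuclideanSpace ℝ (Fin n) →L[ℝ] ℝ))
      y := by
  induction p using MvPolynomial.induction_on with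
  | C a => simpa using hasFDerivAt_const a y
  | add p q hp hq => simpa [add_smul, Finset.sum_add_distrib] using hp.fun_add hq
  | mul_X p j hp =>
    have hX : HasFDerivAt (fun y : EuclideanSpace ℝ (Fin n) => y.ofLp j)
        (EuclideanSpace.proj j : EuclideanSpace ℝ (Fin n) →L[ℝ] ℝ) y :=
      (EuclideanSpace.proj j : EuclideanSpace ℝ (Fin n) →L[ℝ] ℝ).hasFDerivAt
    simp only [map_mul, eval_X]
    refine (hp.fun_mul hX).congr_fderiv ?_
    ext v
    simp [pderiv_X, Finset.sum_add_distrib, add_mul, Pi.single_apply, Finset.mul_sum, mul_ite,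
      apply_ite (eval y.ofLp), ite_mul, mul_assoc]

theorem hasFDerivAt_exp_neg_norm_sq {E : Type*} [NormedAddCommGroup E] [InnerProductSpace ℝ E]
    (y : E) :
    HasFDerivAt (fun y : E => exp (-‖y‖ ^ 2)) (-(2 * exp (-‖y‖ ^ 2)) • innerSL ℝ y) y := by
  refine (hasStrictFDerivAt_norm_sq y).hasFDerivAt.fun_neg.exp.congr_fderiv ?_
  ext v
  simp
  ring

theorem integral_pderiv_mul_exp_neg_sq (p : MvPolynomial (Fin n) ℝ) (i : Fin n) :
    ∫ y : EuclideanSpace ℝ (Fin n), eval y.ofLp (pderiv i p) * exp (-‖y‖ ^ 2) =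
      2 * ∫ y : EuclideanSpace ℝ (Fin n), eval y.ofLp (X i * p) * exp (-‖y‖ ^ 2) := by
  have hderiv : ∀ y : EuclideanSpace ℝ (Fin n),
      fderiv ℝ (fun y : EuclideanSpace ℝ (Fin n) => eval y.ofLp p) y (EuclideanSpace.single i 1) =
        eval y.ofLp (pderiv i p) := fun y => by
    simp [(hasFDerivAt_eval p y).fderiv]
  have hgauss : ∀ y : EuclideanSpace ℝ (Fin n),
      eval y.ofLp p * fderiv ℝ (fun y : EuclideanSpace ℝ (Fin n) => exp (-‖y‖ ^ 2)) y
        (EuclideanSpace.single i 1) = -2 * (eval y.ofLp (X i * p) * exp (-‖y‖ ^ 2)) := fun y => by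
    simp [(hasFDerivAt_exp_neg_norm_sq y).fderiv, EuclideanSpace.inner_single_right]
    ring
  have hparts := integral_mul_fderiv_eq_neg_fderiv_mul_of_integrable (μ := volume)
    (f := fun y : EuclideanSpace ℝ (Fin n) => eval y.ofLp p)
    (g := fun y : EuclideanSpace ℝ (Fin n) => exp (-‖y‖ ^ 2))
    (v := EuclideanSpace.single i 1)
    (by simpa only [hderiv] using integrable_eval_mul_exp_neg_sq _)
    (by simpa only [hgauss] using (integrable_eval_mul_exp_neg_sq (X i * p)).const_mul (-2))
    (integrable_eval_mul_exp_neg_sq p)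
    (fun y _ => (hasFDerivAt_eval p y).differentiableAt)
    (fun y _ => (hasFDerivAt_exp_neg_norm_sq y).differentiableAt)
  simp only [hgauss, hderiv, integral_const_mul] at hparts
  linarith

/-- Integration by parts against a Gaussian weight, whose radial factors on both sides differ by one
step of the functional equation of `Γ`. -/
theorem sphInt_pderiv {m : ℕ} {p : MvPolynomial (Fin n) ℝ} (hp : p.IsHomogeneous m) (i : Fin n) :
    sphInt n (pderiv i p) = ((m : ℝ) + n - 1) * sphInt n (X i * p) := by
  have hn : 1 ≤ n := i.pos
  have hXp : (X i * p).IsHomogeneous (1 + m) := (isHomogeneous_X ℝ i).mul hp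
  have hparts := integral_pderiv_mul_exp_neg_sq p i
  rw [integral_eval_mul_exp_neg_sq hn hp.pderiv, integral_eval_mul_exp_neg_sq hn hXp] at hparts
  have : (0 : ℝ) < n := Nat.cast_pos.2 hn
  rcases m with _ | m
  · have hΓ : 0 < Gamma (((1 + 0 : ℕ) + n) / 2) := Gamma_pos_of_pos (by positivity)
    have hp0 : pderiv i p = 0 := by rw [eq_C_of_isHomogeneous_zero hp, pderiv_C]
    rw [hp0, map_zero, zero_mul] at hparts
    have hzero : sphInt n (X i * p) = 0 :=
      (mul_eq_zero.1 ((mul_eq_zero.1 hparts.symm).resolve_left two_ne_zero)).resolve_right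
        (mul_pos one_half_pos hΓ).ne'
    rw [hp0, hzero, map_zero, mul_zero]
  · have hpos : (0 : ℝ) < (m + n) / 2 := by positivity
    have hΓ : Gamma (((1 + (m + 1) : ℕ) + n) / 2) = (m + n) / 2 * Gamma ((m + n) / 2) := by
      rw [← Gamma_add_one hpos.ne']
      push_cast
      ring_nf
    rw [hΓ, Nat.add_sub_cancel] at hparts
    have hΓ0 : 1 / 2 * Gamma ((m + n) / 2) ≠ 0 :=
      mul_ne_zero one_half_pos.ne' (Gamma_pos_of_pos hpos).ne'
    refine mul_right_cancel₀ hΓ0 (hparts.trans ?_)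
    push_cast
    ring

end SphereIntegral

section SolidHarmonic

open MvPolynomial

variable {n : ℕ}

theorem pderiv_pderiv_comm {σ R : Type*} [CommSemiring R] (i j : σ) (p : MvPolynomial σ R) :
    pderiv i (pderiv j p) = pderiv j (pderiv i p) := by
  classical
  ext a
  by_cases hij : i = j
  · rw [hij]
  · simp only [coeff_pderiv, add_right_comm a]
    simp [hij, Ne.symm hij, mul_right_comm]

theorem polyLaplacian_apply (p : MvPolynomial (Fin n) ℝ) :
    polyLaplacian n p = ∑ i, pderiv i (pderiv i p) := by
  simp [polyLaplacian, LinearMap.sum_apply]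

theorem polyLaplacian_mul (p q : MvPolynomial (Fin n) ℝ) :
    polyLaplacian n (p * q) =
      p * polyLaplacian n q + 2 * ∑ i, pderiv i p * pderiv i q + q * polyLaplacian n p := by
  simp only [polyLaplacian_apply, pderiv_mul, map_add, Finset.mul_sum, ← Finset.sum_add_distrib]
  refine Finset.sum_congr rfl fun i _ => ?_
  ring

theorem polyLaplacian_pderiv (i : Fin n) (p : MvPolynomial (Fin n) ℝ) :
    polyLaplacian n (pderiv i p) = pderiv i (polyLaplacian n p) := by
  simp only [polyLaplacian_apply, map_sum]
  refine Finset.sum_congr rfl fun j _ => ?_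
  rw [pderiv_pderiv_comm j i, pderiv_pderiv_comm j i]

/-- Solid harmonics: the harmonic homogeneous polynomials of degree `k`, whose restrictions to the
sphere are the spherical harmonics of frequency `k`. -/
def IsSolidHarmonic (k : ℕ) (h : MvPolynomial (Fin n) ℝ) : Prop :=
  h.IsHomogeneous k ∧ polyLaplacian n h = 0

theorem IsSolidHarmonic.pderiv {k : ℕ} {h : MvPolynomial (Fin n) ℝ} (hh : IsSolidHarmonic k h)
    (i : Fin n) : IsSolidHarmonic (k - 1) (pderiv i h) :=
  ⟨hh.1.pderiv, by rw [polyLaplacian_pderiv, hh.2, map_zero]⟩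

theorem mem_sphHarm {k : ℕ} {f : Sph n → ℝ} :
    f ∈ sphHarm n k ↔ ∃ h, IsSolidHarmonic k h ∧ restrictSph n h = f := by
  simp [sphHarm, IsSolidHarmonic]

/-- The linear form `⟨x, ·⟩`, as a polynomial. -/
def linForm (x : Fin n → ℝ) : MvPolynomial (Fin n) ℝ := ∑ i, x i • X i

/-- The squared Euclidean norm, as a polynomial. -/
def normSqPoly (n : ℕ) : MvPolynomial (Fin n) ℝ := ∑ i, X i ^ 2

/-- The derivative of polynomials in the direction `x`. -/
def dirDeriv (x : Fin n → ℝ) : Derivation ℝ (MvPolynomial (Fin n) ℝ) (MvPolynomial (Fin n) ℝ) :=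
  ∑ i, x i • pderiv i

theorem dirDeriv_apply (x : Fin n → ℝ) (p : MvPolynomial (Fin n) ℝ) :
    dirDeriv x p = ∑ i, x i • pderiv i p := by
  rw [dirDeriv, ← Derivation.coeFnAddMonoidHom_apply, map_sum, Finset.sum_apply]
  rfl

theorem isHomogeneous_linForm (x : Fin n → ℝ) : (linForm x).IsHomogeneous 1 :=
  (homogeneousSubmodule (Fin n) ℝ 1).sum_mem fun i _ =>
    Submodule.smul_mem _ _ (isHomogeneous_X ℝ i)

theorem isHomogeneous_normSqPoly : (normSqPoly n).IsHomogeneous 2 :=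
  IsHomogeneous.sum _ _ _ fun _ _ => isHomogeneous_X_pow _ _

theorem pderiv_linForm (x : Fin n → ℝ) (i : Fin n) : pderiv i (linForm x) = C (x i) := by
  simp [linForm, pderiv_X, Pi.single_apply, smul_eq_C_mul]

theorem pderiv_normSqPoly (i : Fin n) : pderiv i (normSqPoly n) = (2 : ℝ) • X i := by
  simp [normSqPoly, pderiv_X, Pi.single_apply, smul_eq_C_mul, map_ofNat]

theorem polyLaplacian_linForm (x : Fin n → ℝ) : polyLaplacian n (linForm x) = 0 := by
  simp [polyLaplacian_apply, pderiv_linForm]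

theorem polyLaplacian_normSqPoly : polyLaplacian n (normSqPoly n) = C (2 * n : ℝ) := by
  simp [polyLaplacian_apply, pderiv_normSqPoly, smul_eq_C_mul, mul_comm]

theorem polyLaplacian_linForm_mul (x : Fin n → ℝ) (p : MvPolynomial (Fin n) ℝ) :
    polyLaplacian n (linForm x * p) = linForm x * polyLaplacian n p + 2 * dirDeriv x p := by
  simp only [polyLaplacian_mul, polyLaplacian_linForm, pderiv_linForm, dirDeriv_apply,
    smul_eq_C_mul, mul_zero, add_zero]

theorem polyLaplacian_normSqPoly_mul {k : ℕ} {p : MvPolynomial (Fin n) ℝ}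
    (hp : p.IsHomogeneous k) :
    polyLaplacian n (normSqPoly n * p) =
      normSqPoly n * polyLaplacian n p + (2 * n + 4 * k : ℝ) • p := by
  simp only [polyLaplacian_mul, polyLaplacian_normSqPoly, pderiv_normSqPoly, smul_mul_assoc,
    ← Finset.smul_sum, hp.sum_X_mul_pderiv]
  simp only [smul_eq_C_mul, nsmul_eq_mul, map_add, map_mul, map_natCast, map_ofNat]
  ring

theorem dirDeriv_linForm (x : Fin n → ℝ) : dirDeriv x (linForm x) = C (∑ i, x i ^ 2) := by
  simp [dirDeriv_apply, pderiv_linForm, smul_eq_C_mul, sq]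

theorem dirDeriv_normSqPoly (x : Fin n → ℝ) :
    dirDeriv x (normSqPoly n) = (2 : ℝ) • linForm x := by
  simp only [dirDeriv_apply, pderiv_normSqPoly, linForm, Finset.smul_sum]
  exact Finset.sum_congr rfl fun i _ => smul_comm _ _ _

theorem IsSolidHarmonic.dirDeriv {k : ℕ} {h : MvPolynomial (Fin n) ℝ} (hh : IsSolidHarmonic k h)
    (x : Fin n → ℝ) : IsSolidHarmonic (k - 1) (dirDeriv x h) := by
  rw [dirDeriv_apply]
  refine ⟨(homogeneousSubmodule (Fin n) ℝ (k - 1)).sum_mem fun i _ =>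
    Submodule.smul_mem _ _ (hh.pderiv i).1, ?_⟩
  simp only [map_sum, map_smul, (hh.pderiv _).2, smul_zero, Finset.sum_const_zero]

theorem eval_dirDeriv_self {k : ℕ} {h : MvPolynomial (Fin n) ℝ} (hh : h.IsHomogeneous k)
    (x : Fin n → ℝ) : eval x (dirDeriv x h) = k * eval x h := by
  simpa [dirDeriv_apply, smul_eval] using congrArg (eval x) hh.sum_X_mul_pderiv

theorem sum_sq_sph (x : Sph n) : ∑ i, x.1.ofLp i ^ 2 = 1 := by
  simpa using (EuclideanSpace.norm_sq_eq x.1).symm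

theorem restrictSph_normSqPoly_mul (p : MvPolynomial (Fin n) ℝ) :
    restrictSph n (normSqPoly n * p) = restrictSph n p := by
  ext x
  simp [restrictSph_apply, normSqPoly, sum_sq_sph]

theorem eval_linForm (x z : EuclideanSpace ℝ (Fin n)) :
    eval z.ofLp (linForm x.ofLp) = inner ℝ x z := by
  simp [linForm, PiLp.inner_apply, smul_eval, mul_comm]

end SolidHarmonic

/-! ### Orthogonality of solid harmonics and the Funk–Hecke formula -/

section FunkHecke

open MvPolynomial

variable {n : ℕ}

theorem natCast_add_sub_one_pos (hn : 2 ≤ n) (k : ℕ) : (0 : ℝ) < (k : ℝ) + n - 1 := by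
  have : (2 : ℝ) ≤ n := Nat.ofNat_le_cast.2 hn
  linarith [k.cast_nonneg (α := ℝ)]

theorem sphInt_dirDeriv {m : ℕ} {p : MvPolynomial (Fin n) ℝ} (hp : p.IsHomogeneous m)
    (y : Fin n → ℝ) :
    sphInt n (dirDeriv y p) = ((m : ℝ) + n - 1) * sphInt n (linForm y * p) := by
  rw [dirDeriv_apply, linForm, Finset.sum_mul, map_sum, map_sum, Finset.mul_sum]
  refine Finset.sum_congr rfl fun i _ => ?_
  rw [smul_mul_assoc, map_smul, map_smul, sphInt_pderiv hp, smul_eq_mul, smul_eq_mul,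
    mul_left_comm]

theorem sphInt_polyLaplacian {k : ℕ} {p : MvPolynomial (Fin n) ℝ} (hp : p.IsHomogeneous k) :
    sphInt n (polyLaplacian n p) = (((k - 1 : ℕ) : ℝ) + n - 1) * k * sphInt n p := by
  rw [polyLaplacian_apply, map_sum, Finset.sum_congr rfl fun i _ => sphInt_pderiv hp.pderiv i,
    ← Finset.mul_sum, ← map_sum, hp.sum_X_mul_pderiv, map_nsmul, nsmul_eq_mul, mul_assoc]

theorem sphInt_solidHarmonic (hn : 2 ≤ n) {k : ℕ} (hk : k ≠ 0) {h : MvPolynomial (Fin n) ℝ}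
    (hh : IsSolidHarmonic k h) : sphInt n h = 0 := by
  have hΔ := sphInt_polyLaplacian hh.1
  rw [hh.2, map_zero] at hΔ
  exact (mul_eq_zero.1 hΔ.symm).resolve_left
    (mul_ne_zero (natCast_add_sub_one_pos hn _).ne' (Nat.cast_ne_zero.2 hk))

theorem sphInt_mul_solidHarmonic_of_lt (hn : 2 ≤ n) {m k : ℕ} (hmk : m < k)
    {p h : MvPolynomial (Fin n) ℝ} (hp : p.IsHomogeneous m) (hh : IsSolidHarmonic k h) :
    sphInt n (p * h) = 0 := by
  induction m using Nat.strong_induction_on generalizing k p h with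
  | _ m ih =>
    rcases Nat.eq_zero_or_pos m with rfl | hm
    · rw [eq_C_of_isHomogeneous_zero hp, ← smul_eq_C_mul, map_smul,
        sphInt_solidHarmonic hn hmk.ne' hh, smul_zero]
    have hterm : ∀ i, sphInt n (X i * (pderiv i p * h)) = 0 := fun i => by
      have hparts := sphInt_pderiv ((hp.pderiv (i := i)).mul hh.1) i
      rw [pderiv_mul, map_add, ih (m - 1 - 1) (by omega) (by omega) hp.pderiv.pderiv hh,
        ih (m - 1) (by omega) (by omega) hp.pderiv (hh.pderiv i), add_zero] at hparts
      exact (mul_eq_zero.1 hparts.symm).resolve_left (natCast_add_sub_one_pos hn _).ne'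
    have heuler : m • sphInt n (p * h) = 0 := by
      rw [← map_nsmul, ← smul_mul_assoc, ← hp.sum_X_mul_pderiv, Finset.sum_mul, map_sum]
      exact Finset.sum_eq_zero fun i _ => by rw [mul_assoc, hterm]
    exact (smul_eq_zero.1 heuler).resolve_left hm.ne'

theorem sphInt_solidHarmonic_mul_solidHarmonic (hn : 2 ≤ n) {k l : ℕ} (hkl : k ≠ l)
    {p h : MvPolynomial (Fin n) ℝ} (hp : IsSolidHarmonic k p) (hh : IsSolidHarmonic l h) :
    sphInt n (p * h) = 0 := by
  rcases hkl.lt_or_gt with hlt | hlt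
  · exact sphInt_mul_solidHarmonic_of_lt hn hlt hp.1 hh
  · rw [mul_comm]
    exact sphInt_mul_solidHarmonic_of_lt hn hlt hh.1 hp

theorem sphInt_dirDeriv_linForm_pow_mul {m : ℕ} {h : MvPolynomial (Fin n) ℝ} {y : Fin n → ℝ}
    (hy : ∑ i, y i ^ 2 = 1) :
    sphInt n (dirDeriv y (linForm y ^ m * h)) =
      sphInt n (linForm y ^ m * dirDeriv y h) + m * sphInt n (linForm y ^ (m - 1) * h) := by
  rw [Derivation.leibniz, Derivation.leibniz_pow, dirDeriv_linForm, hy, map_one, smul_eq_mul,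
    smul_eq_mul, smul_eq_mul, mul_one, mul_smul_comm, mul_comm h, map_add, map_nsmul,
    nsmul_eq_mul]

/-- Integrating the derivative of `⟨x, ·⟩ ^ m * h` in the direction `x` by parts trades a power of
`⟨x, ·⟩` for the derivative of `h`, and Euler's identity evaluates the latter at `x`. -/
theorem exists_sphInt_linForm_pow_mul (hn : 2 ≤ n) (m k : ℕ) :
    ∃ A : ℝ, ∀ h : MvPolynomial (Fin n) ℝ, IsSolidHarmonic k h → ∀ x : Sph n,
      sphInt n (linForm x.1.ofLp ^ m * h) = A * restrictSph n h x := by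
  induction m using Nat.strong_induction_on generalizing k with
  | _ m ih =>
    rcases m with _ | m
    · rcases eq_or_ne k 0 with rfl | hk
      · refine ⟨area n, fun h hh x => ?_⟩
        rw [pow_zero, one_mul, eq_C_of_isHomogeneous_zero hh.1, ← mul_one (C _), ← smul_eq_C_mul,
          map_smul, map_smul, sphInt_one]
        simp [restrictSph_apply, mul_comm]
      · refine ⟨0, fun h hh x => ?_⟩
        rw [pow_zero, one_mul, sphInt_solidHarmonic hn hk hh, zero_mul]
    · obtain ⟨A₁, hA₁⟩ := ih (m - 1) (by omega) k
      obtain ⟨A₂, hA₂⟩ := ih m (by omega) (k - 1)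
      refine ⟨(m * A₁ + k * A₂) / ((m + k : ℕ) + n - 1), fun h hh x => ?_⟩
      have hom : (linForm x.1.ofLp ^ m * h).IsHomogeneous (m + k) := by
        simpa using ((isHomogeneous_linForm x.1.ofLp).pow m).mul hh.1
      have heuler : restrictSph n (dirDeriv x.1.ofLp h) x = k * restrictSph n h x :=
        eval_dirDeriv_self hh.1 _
      have hparts := sphInt_dirDeriv hom x.1.ofLp
      rw [sphInt_dirDeriv_linForm_pow_mul (sum_sq_sph x), hA₁ h hh, hA₂ _ (hh.dirDeriv _), heuler,
        ← mul_assoc (linForm _), ← pow_succ'] at hparts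
      rw [div_mul_eq_mul_div, eq_div_iff (natCast_add_sub_one_pos hn _).ne']
      linarith

theorem exists_sphInt_aeval_linForm_mul (hn : 2 ≤ n) (φ : Polynomial ℝ) (k : ℕ) :
    ∃ A : ℝ, ∀ h : MvPolynomial (Fin n) ℝ, IsSolidHarmonic k h → ∀ x : Sph n,
      sphInt n (Polynomial.aeval (linForm x.1.ofLp) φ * h) = A * restrictSph n h x := by
  induction φ using Polynomial.induction_on' with
  | add p q hp hq =>
    obtain ⟨A, hA⟩ := hp
    obtain ⟨B, hB⟩ := hq
    refine ⟨A + B, fun h hh x => ?_⟩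
    rw [map_add, add_mul, map_add, hA h hh, hB h hh, add_mul]
  | monomial m c =>
    obtain ⟨A, hA⟩ := exists_sphInt_linForm_pow_mul hn m k
    refine ⟨c * A, fun h hh x => ?_⟩
    rw [Polynomial.aeval_monomial, mul_assoc, ← Algebra.smul_def, map_smul, hA h hh,
      smul_eq_mul, mul_assoc]

end FunkHecke

section Zonal

open MvPolynomial

variable {n : ℕ}

/-- The solid harmonic whose restriction to the sphere is `z ↦ Q_k(⟨x, z⟩)`, for `x` on the sphere;
its recurrence is that of `gegenbauer`, made homogeneous by powers of `|z|²`. -/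
def zonal (x : Fin n → ℝ) : ℕ → MvPolynomial (Fin n) ℝ
  | 0 => 1
  | 1 => linForm x
  | k + 2 =>
      ((k : ℝ) + n - 1)⁻¹ •
        ((2 * (k : ℝ) + n) • (linForm x * zonal x (k + 1))
          - ((k : ℝ) + 1) • (normSqPoly n * zonal x k))

theorem restrictSph_zonal (x z : Sph n) (k : ℕ) :
    restrictSph n (zonal x.1.ofLp k) z = (gegenbauer n k).eval (inner ℝ x.1 z.1) := by
  induction k using Nat.twoStepInduction with
  | zero => simp [restrictSph_apply, zonal, gegenbauer]
  | one => simp [restrictSph_apply, zonal, gegenbauer, eval_linForm]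
  | more k ih₀ ih₁ =>
    rw [restrictSph_apply] at ih₁
    simp only [zonal, gegenbauer, map_smul, map_sub, restrictSph_normSqPoly_mul, Pi.smul_apply,
      Pi.sub_apply, ih₀]
    simp [restrictSph_apply, eval_linForm, ih₁, mul_assoc]

theorem isHomogeneous_zonal (x : Fin n → ℝ) (k : ℕ) : (zonal x k).IsHomogeneous k := by
  induction k using Nat.twoStepInduction with
  | zero => exact isHomogeneous_one _ _
  | one => exact isHomogeneous_linForm x
  | more k ih₀ ih₁ =>
    have hlin : (linForm x * zonal x (k + 1)).IsHomogeneous (k + 2) := by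
      simpa only [add_comm 1] using (isHomogeneous_linForm x).mul ih₁
    have hsq : (normSqPoly n * zonal x k).IsHomogeneous (k + 2) := by
      simpa only [add_comm 2] using isHomogeneous_normSqPoly.mul ih₀
    exact Submodule.smul_mem (homogeneousSubmodule (Fin n) ℝ (k + 2)) _
      (Submodule.sub_mem _ (Submodule.smul_mem _ _ hlin) (Submodule.smul_mem _ _ hsq))

theorem zonal_recurrence (hn : 2 ≤ n) (x : Fin n → ℝ) (k : ℕ) :
    ((k : ℝ) + n - 1) • zonal x (k + 2) = (2 * (k : ℝ) + n) • (linForm x * zonal x (k + 1))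
      - ((k : ℝ) + 1) • (normSqPoly n * zonal x k) := by
  rw [zonal, smul_inv_smul₀ (natCast_add_sub_one_pos hn k).ne']

theorem dirDeriv_zonal (hn : 2 ≤ n) {x : Fin n → ℝ} (hx : ∑ i, x i ^ 2 = 1) (k : ℕ) :
    dirDeriv x (zonal x (k + 1)) = ((k : ℝ) + 1) • zonal x k := by
  induction k using Nat.strong_induction_on with
  | _ k ih =>
    rcases k with _ | k
    · simp [zonal, dirDeriv_linForm, hx]
    refine smul_right_injective _ (natCast_add_sub_one_pos hn k).ne' ?_
    dsimp only
    rw [← Derivation.map_smul, zonal_recurrence hn, map_sub, Derivation.map_smul,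
      Derivation.map_smul, Derivation.leibniz, Derivation.leibniz, dirDeriv_linForm,
      dirDeriv_normSqPoly, hx, ih k k.lt_succ_self]
    rcases k with _ | k
    · simp only [zonal, Derivation.map_one_eq_zero, smul_eq_C_mul, smul_eq_mul, map_add, map_sub,
        map_mul, map_one, map_natCast, map_ofNat]
      push_cast
      ring
    · rw [ih k (by omega)]
      have hrec := zonal_recurrence hn x k
      simp only [smul_eq_C_mul, smul_eq_mul, map_add, map_sub, map_mul, map_one, map_natCast,
        Nat.cast_add, Nat.cast_one, map_ofNat] at hrec ⊢
      linear_combination -((k : MvPolynomial (Fin n) ℝ) + 2) * hrec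

theorem isSolidHarmonic_zonal (hn : 2 ≤ n) {x : Fin n → ℝ} (hx : ∑ i, x i ^ 2 = 1) (k : ℕ) :
    IsSolidHarmonic k (zonal x k) := by
  refine ⟨isHomogeneous_zonal x k, ?_⟩
  induction k using Nat.twoStepInduction with
  | zero => simp [zonal, polyLaplacian_apply]
  | one => exact polyLaplacian_linForm x
  | more k ih₀ ih₁ =>
    refine smul_right_injective _ (natCast_add_sub_one_pos hn k).ne' ?_
    dsimp only
    rw [← map_smul, zonal_recurrence hn, map_sub, map_smul, map_smul, polyLaplacian_linForm_mul,
      polyLaplacian_normSqPoly_mul (isHomogeneous_zonal x k), ih₀, ih₁, dirDeriv_zonal hn hx]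
    simp only [smul_eq_C_mul, map_add, map_mul, map_one, map_natCast, map_ofNat]
    ring

end Zonal

section Gegenbauer

open Polynomial

variable {n : ℕ}

theorem natDegree_gegenbauer_le (n k : ℕ) : (gegenbauer n k).natDegree ≤ k := by
  induction k using Nat.twoStepInduction with
  | zero => simp [gegenbauer]
  | one => simp [gegenbauer]
  | more k ih₀ ih₁ =>
    rw [gegenbauer, mul_assoc]
    refine (natDegree_C_mul_le _ _).trans ((natDegree_sub_le _ _).trans (max_le ?_ ?_))
    · refine (natDegree_C_mul_le _ _).trans ((natDegree_mul_le_of_le natDegree_X_le ih₁).trans ?_)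
      omega
    · exact (natDegree_C_mul_le _ _).trans (ih₀.trans (Nat.le_add_right k 2))

theorem coeff_gegenbauer_pos (hn : 2 ≤ n) (k : ℕ) : 0 < (gegenbauer n k).coeff k := by
  induction k using Nat.twoStepInduction with
  | zero => simp [gegenbauer]
  | one => simp [gegenbauer]
  | more k _ ih₁ =>
    have hlow : (gegenbauer n k).coeff (k + 2) = 0 :=
      coeff_eq_zero_of_natDegree_lt ((natDegree_gegenbauer_le n k).trans_lt (by omega))
    rw [gegenbauer, coeff_C_mul, coeff_sub, mul_assoc, coeff_C_mul, coeff_C_mul, coeff_X_mul, hlow,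
      mul_zero, sub_zero]
    have hden := natCast_add_sub_one_pos hn k
    have : 0 < n := two_pos.trans_le hn
    positivity

theorem natDegree_gegenbauer (hn : 2 ≤ n) (k : ℕ) : (gegenbauer n k).natDegree = k :=
  natDegree_eq_of_le_of_coeff_ne_zero (natDegree_gegenbauer_le n k) (coeff_gegenbauer_pos hn k).ne'

theorem eval_one_gegenbauer (hn : 2 ≤ n) (k : ℕ) : (gegenbauer n k).eval 1 = 1 := by
  induction k using Nat.twoStepInduction with
  | zero => simp [gegenbauer]
  | one => simp [gegenbauer]
  | more k ih₀ ih₁ =>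
    have hden := natCast_add_sub_one_pos hn k
    simp only [gegenbauer, eval_mul, eval_sub, eval_C, eval_X, ih₀, ih₁]
    field_simp
    ring

theorem integral_comp_inner (hn : 2 ≤ n) (x : Sph n) {φ : ℝ → ℝ} (hφ : Continuous φ) :
    ∫ z : Sph n, φ (inner ℝ x.1 z.1) ∂(surf n) = ∫ t, φ t ∂(coordMeasure n) := by
  rw [← map_inner_surf hn x, integral_map (by fun_prop) hφ.aestronglyMeasurable]

theorem integrable_coordMeasure_of_continuous (hn : 2 ≤ n) {φ : ℝ → ℝ} (hφ : Continuous φ) :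
    Integrable φ (coordMeasure n) := by
  obtain ⟨x⟩ := nonempty_sph (one_le_two.trans hn)
  rw [← map_inner_surf hn x, integrable_map_measure hφ.aestronglyMeasurable (by fun_prop)]
  exact integrable_of_continuous (hφ.comp (by fun_prop))

theorem integral_gegenbauer_mul_gegenbauer (hn : 2 ≤ n) {k l : ℕ} (hkl : k ≠ l) :
    ∫ t, (gegenbauer n k).eval t * (gegenbauer n l).eval t ∂(coordMeasure n) = 0 := by
  obtain ⟨x⟩ := nonempty_sph (one_le_two.trans hn)
  rw [← sphInt_solidHarmonic_mul_solidHarmonic hn hkl (isSolidHarmonic_zonal hn (sum_sq_sph x) k)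
      (isSolidHarmonic_zonal hn (sum_sq_sph x) l), sphInt_apply,
    ← integral_comp_inner hn x ((gegenbauer n k).continuous.fun_mul (gegenbauer n l).continuous)]
  simp only [restrictSph_mul_apply, restrictSph_zonal]

theorem integrableOn_gegenbauer_mul_gegenbauer_mul_weight (hn : 2 ≤ n) (k l : ℕ) :
    IntegrableOn (fun t => (gegenbauer n k).eval t * (gegenbauer n l).eval t * weight n t)
      (Set.Icc (-1) 1) :=
  (integrable_coordMeasure_iff hn).1 (integrable_coordMeasure_of_continuous hn
    ((gegenbauer n k).continuous.fun_mul (gegenbauer n l).continuous))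

theorem setIntegral_gegenbauer_mul_gegenbauer_mul_weight (hn : 2 ≤ n) {k l : ℕ} (hkl : k ≠ l) :
    ∫ t in Set.Icc (-1 : ℝ) 1,
      (gegenbauer n k).eval t * (gegenbauer n l).eval t * weight n t = 0 := by
  have h := integral_gegenbauer_mul_gegenbauer hn hkl
  rw [integral_coordMeasure] at h
  exact (mul_eq_zero.1 h).resolve_left (area_pos (by omega)).ne'

theorem restrictSph_aeval_linForm (φ : ℝ[X]) (x z : Sph n) :
    restrictSph n (aeval (linForm x.1.ofLp) φ) z = φ.eval (inner ℝ x.1 z.1) := by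
  rw [restrictSph_apply, ← eval_linForm, ← MvPolynomial.aeval_eq_eval, ← aeval_algHom_apply,
    ← coe_aeval_eq_eval]

/-- The constant of `exists_sphInt_aeval_linForm_mul` is read off at the zonal harmonic with pole
`x`, which takes the value `1` at `x`. -/
theorem integral_eval_inner_mul (hn : 2 ≤ n) (φ : ℝ[X]) {k : ℕ} {Y : Sph n → ℝ}
    (hY : Y ∈ sphHarm n k) (x : Sph n) :
    ∫ z : Sph n, φ.eval (inner ℝ x.1 z.1) * Y z ∂(surf n) =
      (∫ t, φ.eval t * (gegenbauer n k).eval t ∂(coordMeasure n)) * Y x := by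
  obtain ⟨h, hh, rfl⟩ := mem_sphHarm.1 hY
  obtain ⟨A, hA⟩ := exists_sphInt_aeval_linForm_mul hn φ k
  have hFH : ∀ h : MvPolynomial (Fin n) ℝ, IsSolidHarmonic k h →
      ∫ z : Sph n, φ.eval (inner ℝ x.1 z.1) * restrictSph n h z ∂(surf n) =
        A * restrictSph n h x := fun h hh => by
    simp only [← hA h hh x, sphInt_apply, restrictSph_mul_apply, restrictSph_aeval_linForm]
  have hzonal := hFH _ (isSolidHarmonic_zonal hn (sum_sq_sph x) k)
  have hpole : inner ℝ x.1 x.1 = 1 := by simp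
  simp only [restrictSph_zonal, hpole, eval_one_gegenbauer hn, mul_one] at hzonal
  rw [hFH h hh, ← hzonal,
    integral_comp_inner hn x (φ.continuous.fun_mul (gegenbauer n k).continuous)]

end Gegenbauer

/-! ### Bases of spherical harmonics -/

section Decomposition

open MvPolynomial

variable {n : ℕ}

theorem isHomogeneous_polyLaplacian {m : ℕ} {p : MvPolynomial (Fin n) ℝ} (hp : p.IsHomogeneous m) :
    (polyLaplacian n p).IsHomogeneous (m - 2) := by
  rw [polyLaplacian_apply]
  exact IsHomogeneous.sum _ _ _ fun i _ => hp.pderiv.pderiv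

theorem isSolidHarmonic_of_lt_two {m : ℕ} (hm : m < 2) {p : MvPolynomial (Fin n) ℝ}
    (hp : p.IsHomogeneous m) : IsSolidHarmonic m p := by
  refine ⟨hp, ?_⟩
  rw [polyLaplacian_apply]
  refine Finset.sum_eq_zero fun i _ => ?_
  have hconst : (pderiv i p).IsHomogeneous 0 := by
    simpa only [Nat.sub_eq_zero_of_le (Nat.lt_succ_iff.1 hm)] using hp.pderiv (i := i)
  rw [eq_C_of_isHomogeneous_zero hconst, pderiv_C]

theorem isHomogeneous_normSqPoly_mul {m : ℕ} {q : MvPolynomial (Fin n) ℝ}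
    (hq : q.IsHomogeneous m) : (normSqPoly n * q).IsHomogeneous (m + 2) := by
  simpa only [add_comm 2] using isHomogeneous_normSqPoly.mul hq

theorem exists_eq_smul_sph {E : Type*} [NormedAddCommGroup E] [NormedSpace ℝ E]
    [Nonempty (Metric.sphere (0 : E) 1)] (y : E) :
    ∃ (r : ℝ) (σ : Metric.sphere (0 : E) 1), y = r • σ.1 := by
  rcases eq_or_ne y 0 with rfl | hy
  · exact ⟨0, Classical.arbitrary _, (zero_smul ℝ _).symm⟩
  · refine ⟨‖y‖, ⟨‖y‖⁻¹ • y, ?_⟩, (smul_inv_smul₀ (norm_ne_zero_iff.2 hy) y).symm⟩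
    rw [mem_sphere_zero_iff_norm, norm_smul, norm_inv, norm_norm,
      inv_mul_cancel₀ (norm_ne_zero_iff.2 hy)]

theorem eq_zero_of_restrictSph_eq_zero (hn : 1 ≤ n) {m : ℕ} {q : MvPolynomial (Fin n) ℝ}
    (hq : q.IsHomogeneous m) (h : restrictSph n q = 0) : q = 0 := by
  have := nonempty_sph hn
  refine hq.eq_zero_of_forall_eval_eq_zero fun y => ?_
  obtain ⟨r, σ, hy⟩ := exists_eq_smul_sph (WithLp.toLp 2 y)
  obtain rfl : y = r • σ.1.ofLp := congrArg WithLp.ofLp hy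
  rw [eval_smul_of_isHomogeneous hq, ← restrictSph_apply, h, Pi.zero_apply, mul_zero]

theorem restrictSph_eq_zero_of_sphInt_mul_self {q : MvPolynomial (Fin n) ℝ}
    (h : sphInt n (q * q) = 0) : restrictSph n q = 0 := by
  have hnonneg : 0 ≤ restrictSph n (q * q) := fun x => by
    rw [restrictSph_mul_apply]
    exact mul_self_nonneg _
  rw [sphInt_apply, integral_eq_zero_iff_of_nonneg hnonneg (integrable_restrictSph _),
    (continuous_restrictSph _).ae_eq_iff_eq (surf n) continuous_zero] at h
  ext x
  simpa only [restrictSph_mul_apply, Pi.zero_apply, mul_self_eq_zero] using congrFun h x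

/-- `|z|² q` agrees with `q` on the sphere, so if it were harmonic it would be orthogonal there to
the polynomial `q` of lower degree, that is, to itself. -/
theorem eq_zero_of_polyLaplacian_normSqPoly_mul_eq_zero (hn : 2 ≤ n) {m : ℕ}
    {q : MvPolynomial (Fin n) ℝ} (hq : q.IsHomogeneous m)
    (h : polyLaplacian n (normSqPoly n * q) = 0) : q = 0 := by
  refine eq_zero_of_restrictSph_eq_zero (one_le_two.trans hn) hq
    (restrictSph_eq_zero_of_sphInt_mul_self ?_)
  have horth := sphInt_mul_solidHarmonic_of_lt hn (Nat.lt_add_of_pos_right two_pos) hq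
    ⟨isHomogeneous_normSqPoly_mul hq, h⟩
  rwa [mul_left_comm, sphInt_apply, restrictSph_normSqPoly_mul, ← sphInt_apply] at horth

theorem exists_isSolidHarmonic_add_normSqPoly_mul (hn : 2 ≤ n) {m : ℕ}
    {p : MvPolynomial (Fin n) ℝ} (hp : p.IsHomogeneous (m + 2)) :
    ∃ h q, IsSolidHarmonic (m + 2) h ∧ q.IsHomogeneous m ∧ p = h + normSqPoly n * q := by
  have : Module.Finite ℝ (homogeneousSubmodule (Fin n) ℝ m) :=
    Module.Finite.iff_fg.2 (homogeneousSubmodule_fg _ _ m)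
  let L := (polyLaplacian n ∘ₗ LinearMap.mulLeft ℝ (normSqPoly n)).restrict
    (p := homogeneousSubmodule (Fin n) ℝ m) (q := homogeneousSubmodule (Fin n) ℝ m)
    fun q hq => isHomogeneous_polyLaplacian (isHomogeneous_normSqPoly_mul hq)
  have hinj : Function.Injective L := (injective_iff_map_eq_zero L).2 fun q hq =>
    Subtype.ext (eq_zero_of_polyLaplacian_normSqPoly_mul_eq_zero hn q.2 (congrArg Subtype.val hq))
  obtain ⟨q, hLq⟩ := LinearMap.injective_iff_surjective.1 hinj
    ⟨polyLaplacian n p, isHomogeneous_polyLaplacian hp⟩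
  have hΔ : polyLaplacian n (normSqPoly n * q) = polyLaplacian n p := congrArg Subtype.val hLq
  exact ⟨p - normSqPoly n * q, q, ⟨hp.sub (isHomogeneous_normSqPoly_mul q.2), by
    rw [map_sub, hΔ, sub_self]⟩, q.2, (sub_add_cancel _ _).symm⟩

theorem restrictSph_mem_iSup_sphHarm_of_isHomogeneous (hn : 2 ≤ n) {m : ℕ}
    {p : MvPolynomial (Fin n) ℝ} (hp : p.IsHomogeneous m) :
    restrictSph n p ∈ ⨆ k, sphHarm n k := by
  have hmem : ∀ {k : ℕ} {h : MvPolynomial (Fin n) ℝ}, IsSolidHarmonic k h →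
      restrictSph n h ∈ ⨆ k, sphHarm n k := fun hh =>
    Submodule.mem_iSup_of_mem _ (mem_sphHarm.2 ⟨_, hh, rfl⟩)
  induction m using Nat.twoStepInduction generalizing p with
  | zero => exact hmem (isSolidHarmonic_of_lt_two zero_lt_two hp)
  | one => exact hmem (isSolidHarmonic_of_lt_two one_lt_two hp)
  | more m ih _ =>
    obtain ⟨h, q, hh, hq, rfl⟩ := exists_isSolidHarmonic_add_normSqPoly_mul hn hp
    rw [map_add, restrictSph_normSqPoly_mul]
    exact Submodule.add_mem _ (hmem hh) (ih hq)

theorem restrictSph_mem_iSup_sphHarm (hn : 2 ≤ n) (p : MvPolynomial (Fin n) ℝ) :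
    restrictSph n p ∈ ⨆ k, sphHarm n k := by
  rw [← sum_homogeneousComponent p, map_sum]
  exact Submodule.sum_mem _ fun i _ =>
    restrictSph_mem_iSup_sphHarm_of_isHomogeneous hn (homogeneousComponent_isHomogeneous i p)

theorem continuous_of_mem_sphHarm {k : ℕ} {f : Sph n → ℝ} (hf : f ∈ sphHarm n k) :
    Continuous f := by
  obtain ⟨h, _, rfl⟩ := mem_sphHarm.1 hf
  exact continuous_restrictSph h

theorem integral_mul_eq_zero_of_ne (hn : 2 ≤ n) {k l : ℕ} (hkl : k ≠ l) {f g : Sph n → ℝ}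
    (hf : f ∈ sphHarm n k) (hg : g ∈ sphHarm n l) : ∫ x, f x * g x ∂(surf n) = 0 := by
  obtain ⟨p, hp, rfl⟩ := mem_sphHarm.1 hf
  obtain ⟨q, hq, rfl⟩ := mem_sphHarm.1 hg
  simpa only [sphInt_apply, restrictSph_mul_apply] using
    sphInt_solidHarmonic_mul_solidHarmonic hn hkl hp hq

instance finite_sphHarm (k : ℕ) : Module.Finite ℝ (sphHarm n k) := by
  have : Module.Finite ℝ (homogeneousSubmodule (Fin n) ℝ k) :=
    Module.Finite.iff_fg.2 (homogeneousSubmodule_fg _ _ k)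
  have : Module.Finite ℝ (homogeneousSubmodule (Fin n) ℝ k ⊓ LinearMap.ker (polyLaplacian n) :
      Submodule ℝ _) := Submodule.finiteDimensional_inf_left _ _
  exact Module.Finite.map _ _

end Decomposition

section Basis

variable {n : ℕ} {Y : (k : ℕ) → Fin (numHarm n k) → Sph n → ℝ}

theorem IsSHBasis.continuous (hY : IsSHBasis n Y) (k : ℕ) (j : Fin (numHarm n k)) :
    Continuous (Y k j) :=
  continuous_of_mem_sphHarm (hY.mem k j)

theorem IsSHBasis.integral_sum_mul (hY : IsSHBasis n Y) (k : ℕ) (c : Fin (numHarm n k) → ℝ)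
    (i : Fin (numHarm n k)) : ∫ x, (∑ j, c j • Y k j) x * Y k i x ∂(surf n) = c i := by
  simp only [Finset.sum_apply, Pi.smul_apply, smul_eq_mul, Finset.sum_mul, mul_assoc]
  rw [integral_finsetSum _ fun j _ => (integrable_of_continuous
    ((hY.continuous k j).fun_mul (hY.continuous k i))).const_mul _]
  simp [integral_const_mul, hY.orthonormal]

theorem IsSHBasis.span_eq (hY : IsSHBasis n Y) (k : ℕ) :
    Submodule.span ℝ (Set.range (Y k)) = sphHarm n k := by
  have hli : LinearIndependent ℝ (Y k) := Fintype.linearIndependent_iff.2 fun c hc i => by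
    rw [← hY.integral_sum_mul k c i, hc]
    simp
  refine Submodule.eq_of_le_of_finrank_eq
    (Submodule.span_le.2 (Set.range_subset_iff.2 (hY.mem k))) ?_
  rw [finrank_span_eq_card hli, Fintype.card_fin, numHarm]

theorem IsSHBasis.eq_sum (hY : IsSHBasis n Y) {k : ℕ} {f : Sph n → ℝ} (hf : f ∈ sphHarm n k) :
    f = ∑ j, (∫ z, f z * Y k j z ∂(surf n)) • Y k j := by
  rw [← hY.span_eq k, Submodule.mem_span_range_iff_exists_fun] at hf
  obtain ⟨c, rfl⟩ := hf
  simp only [hY.integral_sum_mul]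

theorem IsSHBasis.restrictSph_mem_span (hn : 2 ≤ n) (hY : IsSHBasis n Y)
    (p : MvPolynomial (Fin n) ℝ) : restrictSph n p ∈ Submodule.span ℝ
      (Set.range fun a : (k : ℕ) × Fin (numHarm n k) => Y a.1 a.2) := by
  rw [Set.range_sigma_eq_iUnion_range, Submodule.span_iUnion]
  simpa only [hY.span_eq] using restrictSph_mem_iSup_sphHarm hn p

theorem IsSHBasis.integral_mul (hn : 2 ≤ n) (hY : IsSHBasis n Y)
    (a b : (k : ℕ) × Fin (numHarm n k)) :
    ∫ x, Y a.1 a.2 x * Y b.1 b.2 x ∂(surf n) = if a = b then 1 else 0 := by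
  obtain ⟨k, i⟩ := a
  obtain ⟨l, j⟩ := b
  rcases eq_or_ne k l with rfl | hkl
  · simp [hY.orthonormal]
  · rw [integral_mul_eq_zero_of_ne hn hkl (hY.mem _ _) (hY.mem _ _),
      if_neg fun h => hkl (congrArg Sigma.fst h)]

/-- The squared `L²` norm of the Gegenbauer polynomial `Q_k` with respect to the distribution of the
dot product; by the addition theorem it is the reciprocal of `∑ j, Y_{kj}(x)²` for every `x`. -/
def gegNorm (n k : ℕ) : ℝ :=
  ∫ t, (gegenbauer n k).eval t * (gegenbauer n k).eval t ∂(coordMeasure n)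

/-- The addition theorem, from the expansion of the zonal harmonic with pole `x` in the basis. -/
theorem IsSHBasis.gegNorm_mul_sum_mul (hn : 2 ≤ n) (hY : IsSHBasis n Y) (k : ℕ) (x z : Sph n) :
    gegNorm n k * ∑ j, Y k j x * Y k j z = (gegenbauer n k).eval (inner ℝ x.1 z.1) := by
  have hexpand := congrFun (hY.eq_sum (mem_sphHarm.2
    ⟨_, isSolidHarmonic_zonal hn (sum_sq_sph x) k, rfl⟩)) z
  simp only [Finset.sum_apply, Pi.smul_apply, smul_eq_mul, restrictSph_zonal,
    integral_eval_inner_mul hn _ (hY.mem k _), mul_assoc] at hexpand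
  rw [hexpand, ← Finset.mul_sum, gegNorm]

theorem IsSHBasis.gegNorm_mul_sum_sq (hn : 2 ≤ n) (hY : IsSHBasis n Y) (k : ℕ) (x : Sph n) :
    gegNorm n k * ∑ j, Y k j x ^ 2 = 1 := by
  simpa [sq, eval_one_gegenbauer hn] using hY.gegNorm_mul_sum_mul hn k x x

theorem IsSHBasis.gegNorm_pos (hn : 2 ≤ n) (hY : IsSHBasis n Y) (k : ℕ) : 0 < gegNorm n k := by
  obtain ⟨x⟩ := nonempty_sph (one_le_two.trans hn)
  exact (integral_nonneg fun t => mul_self_nonneg _).lt_of_ne'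
    (left_ne_zero_of_mul_eq_one (hY.gegNorm_mul_sum_sq hn k x))

theorem IsSHBasis.sum_sq (hn : 2 ≤ n) (hY : IsSHBasis n Y) (k : ℕ) (x : Sph n) :
    ∑ j, Y k j x ^ 2 = (gegNorm n k)⁻¹ :=
  eq_inv_of_mul_eq_one_right (hY.gegNorm_mul_sum_sq hn k x)

end Basis

/-! ### SH-products -/

section Products

open MvPolynomial

variable {n d : ℕ} {Y : (k : ℕ) → Fin (numHarm n k) → Sph n → ℝ}

theorem denseRange_aeval {σ α : Type*} [TopologicalSpace α] [CompactSpace α] (f : σ → C(α, ℝ))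
    (hf : ∀ x y, (∀ s, f s x = f s y) → x = y) : DenseRange (aeval (R := ℝ) f) := by
  have hsep : (aeval (R := ℝ) f).range.SeparatesPoints := by
    intro x y hxy
    obtain ⟨s, hs⟩ : ∃ s, f s x ≠ f s y := by
      by_contra! h
      exact hxy (hf x y h)
    exact ⟨_, ⟨f s, ⟨X s, aeval_X f s⟩, rfl⟩, hs⟩
  have htop := ContinuousMap.subalgebra_topologicalClosure_eq_top_of_separatesPoints _ hsep
  exact fun g => (SetLike.ext_iff.1 htop g).2 trivial

theorem IsSHBasis.continuous_shProd (hY : IsSHBasis n Y) (p : SHIndex n d) :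
    Continuous (shProd Y p) :=
  continuous_finsetProd _ fun i _ => (hY.continuous _ _).comp (continuous_apply i)

theorem shIndex_eq_iff {p q : SHIndex n d} :
    p = q ↔ ∀ i, (⟨p.1 i, p.2 i⟩ : Σ k, Fin (numHarm n k)) = ⟨q.1 i, q.2 i⟩ := by
  refine ⟨fun h i => by rw [h], fun h => ?_⟩
  obtain ⟨k, j⟩ := p
  obtain ⟨l, j'⟩ := q
  obtain rfl : k = l := funext fun i => congrArg Sigma.fst (h i)
  obtain rfl : j = j' := funext fun i => by simpa using h i
  rfl

open Classical in
theorem IsSHBasis.integral_shProd_mul (hn : 2 ≤ n) (hY : IsSHBasis n Y) (p q : SHIndex n d) :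
    ∫ x, shProd Y p x * shProd Y q x ∂(unif n d) = if p = q then 1 else 0 := by
  simp only [shProd, ← Finset.prod_mul_distrib, unif_eq_pi]
  rw [integral_fintype_prod_eq_prod fun i x => Y (p.1 i) (p.2 i) x * Y (q.1 i) (q.2 i) x]
  trans ∏ i, if (⟨p.1 i, p.2 i⟩ : Σ k, Fin (numHarm n k)) = ⟨q.1 i, q.2 i⟩ then (1 : ℝ) else 0
  · exact Finset.prod_congr rfl fun i _ => by rw [← hY.integral_mul hn]
  · simp only [shIndex_eq_iff]
    convert Fintype.prod_boole

/-- The SH-product as an element of `C(MS n d, ℝ)`. -/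
def IsSHBasis.shCM (hY : IsSHBasis n Y) (p : SHIndex n d) : C(MS n d, ℝ) :=
  ⟨shProd Y p, hY.continuous_shProd p⟩

theorem IsSHBasis.prod_restrictSph_mem_span (hn : 2 ≤ n) (hY : IsSHBasis n Y)
    (p : Fin d → MvPolynomial (Fin n) ℝ) {F : C(MS n d, ℝ)}
    (hF : ∀ x, F x = ∏ i, restrictSph n (p i) (x i)) :
    F ∈ Submodule.span ℝ (Set.range (hY.shCM (d := d))) := by
  choose c hc using fun i =>
    Finsupp.mem_span_range_iff_exists_finsupp.1 (hY.restrictSph_mem_span hn (p i))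
  have hp (i : Fin d) (y : Sph n) :
      restrictSph n (p i) y = ∑ a ∈ (c i).support, c i a * Y a.1 a.2 y := by
    simp [← hc i, Finsupp.sum, Finset.sum_apply]
  have hsum : F = ∑ a ∈ Fintype.piFinset fun i => (c i).support,
      (∏ i, c i (a i)) • hY.shCM ⟨fun i => (a i).1, fun i => (a i).2⟩ := by
    ext x
    simp only [hF, hp, Finset.prod_univ_sum, Finset.prod_mul_distrib, ContinuousMap.coe_sum,
      Finset.sum_apply]
    rfl
  rw [hsum]
  exact Submodule.sum_mem _ fun a _ => Submodule.smul_mem _ _ (Submodule.subset_span ⟨_, rfl⟩)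

/-- The `a`-th Cartesian coordinate of the `i`-th factor of the multisphere. These functions
generate the algebra to which the Stone–Weierstrass theorem is applied. -/
def coordCM (ia : Fin d × Fin n) : C(MS n d, ℝ) :=
  ⟨fun x => (x ia.1).1 ia.2, by fun_prop⟩

theorem IsSHBasis.aeval_coordCM_mem_span (hn : 2 ≤ n) (hY : IsSHBasis n Y)
    (P : MvPolynomial (Fin d × Fin n) ℝ) :
    aeval coordCM P ∈ Submodule.span ℝ (Set.range (hY.shCM (d := d))) := by
  induction P using MvPolynomial.induction_on' with
  | monomial s c =>
    rw [aeval_monomial, ← Algebra.smul_def]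
    refine Submodule.smul_mem _ _
      (hY.prod_restrictSph_mem_span hn (fun i => ∏ a, X a ^ s (i, a)) fun x => ?_)
    simp [Finsupp.prod_fintype, Fintype.prod_prod_type, restrictSph_apply, coordCM,
      ContinuousMap.prod_apply]
  | add P Q hP hQ => simpa only [map_add] using Submodule.add_mem _ hP hQ

theorem IsSHBasis.topologicalClosure_span_shCM (hn : 2 ≤ n) (hY : IsSHBasis n Y) :
    (Submodule.span ℝ (Set.range (hY.shCM (d := d)))).topologicalClosure = ⊤ := by
  have hinj (x y : MS n d) (h : ∀ ia, coordCM ia x = coordCM ia y) : x = y :=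
    funext fun i => Subtype.ext (PiLp.ext fun a => h (i, a))
  rw [← Submodule.dense_iff_topologicalClosure_eq_top]
  refine (denseRange_aeval coordCM hinj).mono ?_
  rintro _ ⟨P, rfl⟩
  exact hY.aeval_coordCM_mem_span hn P

/-- The SH-product as an element of `L²`. -/
def IsSHBasis.shLp (hY : IsSHBasis n Y) (p : SHIndex n d) : Lp ℝ 2 (unif n d) :=
  ContinuousMap.toLp 2 (unif n d) ℝ (hY.shCM p)

theorem IsSHBasis.coeFn_shLp (hY : IsSHBasis n Y) (p : SHIndex n d) :
    hY.shLp p =ᵐ[unif n d] shProd Y p :=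
  ContinuousMap.coeFn_toLp _ _

theorem IsSHBasis.inner_shLp (hY : IsSHBasis n Y) (p : SHIndex n d) (f : Lp ℝ 2 (unif n d)) :
    inner ℝ (hY.shLp p) f = ∫ x, f x * shProd Y p x ∂(unif n d) := by
  rw [L2.inner_def]
  refine integral_congr_ae ?_
  filter_upwards [hY.coeFn_shLp p] with x hx
  simp [hx]

theorem IsSHBasis.orthonormal_shLp (hn : 2 ≤ n) (hY : IsSHBasis n Y) :
    Orthonormal ℝ (hY.shLp (d := d)) := by
  classical
  refine orthonormal_iff_ite.2 fun p q => ?_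
  rw [shLp, shLp, ContinuousMap.inner_toLp, ← hY.integral_shProd_mul hn p q]
  exact integral_congr_ae (.of_forall fun x => mul_comm _ _)

theorem IsSHBasis.topologicalClosure_span_shLp (hn : 2 ≤ n) (hY : IsSHBasis n Y) :
    (Submodule.span ℝ (Set.range (hY.shLp (d := d)))).topologicalClosure = ⊤ := by
  have hdense := (ContinuousMap.toLp_denseRange ℝ (unif n d) ℝ
    (ENNReal.ofNat_ne_top (n := 2))).topologicalClosure_map_submodule
      (hY.topologicalClosure_span_shCM hn)
  rw [Submodule.map_span, ← Set.range_comp] at hdense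
  exact hdense

/-- The SH-products as a Hilbert basis of `L²`. -/
def IsSHBasis.hilbertBasis (hn : 2 ≤ n) (hY : IsSHBasis n Y) :
    HilbertBasis (SHIndex n d) ℝ (Lp ℝ 2 (unif n d)) :=
  HilbertBasis.mk (hY.orthonormal_shLp hn) (hY.topologicalClosure_span_shLp hn).ge

theorem IsSHBasis.coe_hilbertBasis (hn : 2 ≤ n) (hY : IsSHBasis n Y) :
    ⇑(hY.hilbertBasis (d := d) hn) = hY.shLp :=
  HilbertBasis.coe_mk _ _

theorem IsSHBasis.ae_eq_zero (hn : 2 ≤ n) (hY : IsSHBasis n Y) {f : MS n d → ℝ}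
    (hf : MemLp f 2 (unif n d)) (h : ∀ p : SHIndex n d, ∫ x, f x * shProd Y p x ∂(unif n d) = 0) :
    f =ᵐ[unif n d] 0 := by
  have hrepr : (hY.hilbertBasis hn).repr (hf.toLp f) = 0 := by
    ext p
    rw [HilbertBasis.repr_apply_apply, hY.coe_hilbertBasis, hY.inner_shLp, lp.coeFn_zero,
      Pi.zero_apply, ← h p]
    refine integral_congr_ae ?_
    filter_upwards [hf.coeFn_toLp] with x hx
    rw [hx]
  have hzero : hf.toLp f = 0 := (LinearIsometryEquiv.map_eq_zero_iff _).1 hrepr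
  exact hf.coeFn_toLp.symm.trans (by rw [hzero]; exact Lp.coeFn_zero ..)

end Products

/-! ### The Funk–Hecke formula on the multisphere -/

section FunkHecke

open MvPolynomial Filter Topology

theorem tendsto_integral_mul_of_tendsto_integral_abs_sub {α ι : Type*} {m : MeasurableSpace α}
    {μ : Measure α} {l : Filter ι} {F : ι → α → ℝ} {g h : α → ℝ} {M : ℝ}
    (hF : ∀ i, Integrable (F i) μ) (hg : Integrable g μ) (hh : AEStronglyMeasurable h μ)
    (hM : ∀ᵐ x ∂μ, |h x| ≤ M) (hlim : Tendsto (fun i => ∫ x, |g x - F i x| ∂μ) l (𝓝 0)) :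
    Tendsto (fun i => ∫ x, F i x * h x ∂μ) l (𝓝 (∫ x, g x * h x ∂μ)) := by
  have hbound (i : ι) : |∫ x, F i x * h x ∂μ - ∫ x, g x * h x ∂μ| ≤ (∫ x, |g x - F i x| ∂μ) * M :=
    calc |∫ x, F i x * h x ∂μ - ∫ x, g x * h x ∂μ|
        = |∫ x, (F i x - g x) * h x ∂μ| := by
          rw [← integral_sub ((hF i).mul_bdd hh hM) (hg.mul_bdd hh hM)]
          simp only [sub_mul]
      _ ≤ ∫ x, |(F i x - g x) * h x| ∂μ := abs_integral_le_integral_abs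
      _ ≤ ∫ x, |g x - F i x| * M ∂μ := by
          refine integral_mono_ae (((hF i).sub hg).mul_bdd hh hM).abs
            ((hg.sub (hF i)).abs.mul_const M) ?_
          filter_upwards [hM] with x hx
          rw [abs_mul, abs_sub_comm]
          gcongr
      _ = (∫ x, |g x - F i x| ∂μ) * M := integral_mul_const _ _
  rw [tendsto_iff_dist_tendsto_zero]
  exact squeeze_zero (fun i => dist_nonneg) hbound (by simpa using hlim.mul_const M)

theorem integrable_of_continuousOn_of_ae_mem {α E : Type*} [TopologicalSpace α] [T2Space α]
    [MeasurableSpace α] [OpensMeasurableSpace α] [NormedAddCommGroup E] {μ : Measure α}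
    [IsFiniteMeasureOnCompacts μ] {S : Set α} (hS : IsCompact S) (hμ : ∀ᵐ t ∂μ, t ∈ S) {g : α → E}
    (hg : ContinuousOn g S) : Integrable g μ := by
  rw [← Measure.restrict_eq_self_of_ae_mem hμ]
  exact hg.integrableOn_compact' hS hS.measurableSet

section Density

variable {ι : Type*} {S : Set (ι → ℝ)} {g : (ι → ℝ) → ℝ}

theorem exists_mvPolynomial_abs_sub_lt (hS : IsCompact S) (hg : ContinuousOn g S) {ε : ℝ}
    (hε : 0 < ε) : ∃ φ : MvPolynomial ι ℝ, ∀ t ∈ S, |g t - eval t φ| < ε := by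
  have : CompactSpace S := isCompact_iff_compactSpace.1 hS
  let coord (i : ι) : C(S, ℝ) := ⟨fun t => t.1 i, (continuous_apply i).comp continuous_subtype_val⟩
  have heval (φ : MvPolynomial ι ℝ) (t : S) : aeval coord φ t = eval t.1 φ := by
    induction φ using MvPolynomial.induction_on with
    | C a => simp
    | add p q hp hq => simp [hp, hq]
    | mul_X p i hp => simp [hp, coord]
  obtain ⟨φ, hφ⟩ := (denseRange_aeval coord fun s t h => Subtype.ext (funext h)).exists_dist_lt
    ⟨S.domRestrict g, hg.domRestrict⟩ hε
  refine ⟨φ, fun t ht => ?_⟩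
  rw [← heval φ ⟨t, ht⟩]
  exact (ContinuousMap.dist_lt_iff hε).1 hφ ⟨t, ht⟩

variable [Countable ι] {μ : Measure (ι → ℝ)} [IsFiniteMeasure μ]

theorem exists_mvPolynomial_integral_abs_sub_lt (hS : IsCompact S) (hμ : ∀ᵐ t ∂μ, t ∈ S)
    (hg : Integrable g μ) {ε : ℝ} (hε : 0 < ε) :
    ∃ φ : MvPolynomial ι ℝ, ∫ t, |g t - eval t φ| ∂μ < ε := by
  obtain ⟨g₀, hgg₀, hg₀⟩ := hg.exists_boundedContinuous_integral_sub_le (half_pos hε)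
  obtain ⟨δ, hδ, hδε⟩ : ∃ δ > 0, μ.real Set.univ * δ < ε / 2 :=
    exists_pos_mul_lt (half_pos hε) (μ.real Set.univ)
  obtain ⟨φ, hφ⟩ := exists_mvPolynomial_abs_sub_lt hS g₀.continuous.continuousOn hδ
  have hφi : Integrable (fun t => eval t φ) μ :=
    integrable_of_continuousOn_of_ae_mem hS hμ (continuous_eval φ).continuousOn
  refine ⟨φ, ?_⟩
  calc ∫ t, |g t - eval t φ| ∂μ
      ≤ ∫ t, (|g t - g₀ t| + |g₀ t - eval t φ|) ∂μ :=
        integral_mono (hg.sub hφi).abs ((hg.sub hg₀).abs.add (hg₀.sub hφi).abs)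
          fun t => abs_sub_le _ _ _
    _ = (∫ t, |g t - g₀ t| ∂μ) + ∫ t, |g₀ t - eval t φ| ∂μ :=
        integral_add (hg.sub hg₀).abs (hg₀.sub hφi).abs
    _ ≤ ε / 2 + ∫ _, δ ∂μ := by
        refine add_le_add hgg₀ (integral_mono_ae (hg₀.sub hφi).abs (integrable_const δ) ?_)
        filter_upwards [hμ] with t ht using (hφ t ht).le
    _ < ε := by
        rw [integral_const, smul_eq_mul]
        linarith

theorem exists_seq_mvPolynomial_tendsto_integral_abs_sub (hS : IsCompact S)
    (hμ : ∀ᵐ t ∂μ, t ∈ S) (hg : Integrable g μ) :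
    ∃ φ : ℕ → MvPolynomial ι ℝ,
      Tendsto (fun m => ∫ t, |g t - eval t (φ m)| ∂μ) atTop (𝓝 0) := by
  choose φ hφ using fun m : ℕ =>
    exists_mvPolynomial_integral_abs_sub_lt hS hμ hg (Nat.one_div_pos_of_nat (α := ℝ) (n := m))
  exact ⟨φ, squeeze_zero (fun m => integral_nonneg fun t => abs_nonneg _) (fun m => (hφ m).le)
    tendsto_one_div_add_atTop_nhds_zero_nat⟩

end Density

variable {n d : ℕ} {Y : (k : ℕ) → Fin (numHarm n k) → Sph n → ℝ} {g : (Fin d → ℝ) → ℝ}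

theorem measurePreserving_dots (hn : 2 ≤ n) (x : MS n d) :
    MeasurePreserving (dots x) (unif n d) (dotsMeasure n d) :=
  ⟨measurable_dots x, map_dots_unif hn x⟩

theorem integrable_comp_dots (hn : 2 ≤ n) (hg : Integrable g (dotsMeasure n d)) (x : MS n d) :
    Integrable (fun z => g (dots x z)) (unif n d) :=
  (measurePreserving_dots hn x).integrable_comp_of_integrable hg

theorem integral_comp_dots (hn : 2 ≤ n) (hg : AEStronglyMeasurable g (dotsMeasure n d))
    (x : MS n d) : ∫ z, g (dots x z) ∂(unif n d) = ∫ t, g t ∂(dotsMeasure n d) := by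
  rw [← map_dots_unif hn x] at hg ⊢
  exact (integral_map (measurable_dots x).aemeasurable hg).symm

theorem integrable_dotsMeasure_of_continuousOn (hg : ContinuousOn g (cube d)) :
    Integrable g (dotsMeasure n d) :=
  integrable_of_continuousOn_of_ae_mem (isCompact_cube d) (ae_mem_cube n d) hg

/-- The product `Q_{k_1}(t_1) ⋯ Q_{k_d}(t_d)` of Gegenbauer polynomials, against which `κ` is
integrated in the definition of `λ_k`. -/
def gegProd (n : ℕ) (k : Fin d → ℕ) (t : Fin d → ℝ) : ℝ := ∏ i, (gegenbauer n (k i)).eval (t i)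

theorem continuous_gegProd (k : Fin d → ℕ) : Continuous (gegProd n k) :=
  continuous_finsetProd _ fun i _ => (Polynomial.continuous _).comp (continuous_apply i)

theorem eigval_eq_integral (κ : (Fin d → ℝ) → ℝ) (k : Fin d → ℕ) :
    eigval n κ k = ∫ t, κ t * gegProd n k t ∂(dotsMeasure n d) := by
  simp only [integral_dotsMeasure, eigval, gegProd, Finset.prod_mul_distrib, mul_assoc]

theorem IsSHBasis.integral_eval_dots_mul (hn : 2 ≤ n) (hY : IsSHBasis n Y)
    (φ : MvPolynomial (Fin d) ℝ) (p : SHIndex n d) (x : MS n d) :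
    ∫ z, eval (dots x z) φ * shProd Y p z ∂(unif n d) =
      eigval n (fun t => eval t φ) p.1 * shProd Y p x := by
  rw [eigval_eq_integral]
  have hcont (φ : MvPolynomial (Fin d) ℝ) : Continuous fun z : MS n d => eval (dots x z) φ :=
    (continuous_eval φ).comp (continuous_dots.comp (Continuous.prodMk_right x))
  have hint₁ (φ : MvPolynomial (Fin d) ℝ) := integrable_of_continuous (μ := unif n d)
    ((hcont φ).fun_mul (hY.continuous_shProd p))
  have hint₂ (φ : MvPolynomial (Fin d) ℝ) := integrable_dotsMeasure_of_continuousOn (n := n)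
    ((continuous_eval φ).fun_mul (continuous_gegProd (n := n) p.1)).continuousOn
  induction φ using MvPolynomial.induction_on' with
  | add φ ψ hφ hψ =>
    simp only [map_add, add_mul]
    rw [integral_add (hint₁ φ) (hint₁ ψ), integral_add (hint₂ φ) (hint₂ ψ), add_mul, hφ, hψ]
  | monomial a c =>
    have hmon (t : Fin d → ℝ) : eval t (monomial a c) = c * ∏ i, t i ^ a i := by
      rw [eval_monomial, Finsupp.prod_fintype _ _ (by simp)]
    simp only [hmon, shProd, gegProd, mul_assoc, ← Finset.prod_mul_distrib, integral_const_mul]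
    rw [unif_eq_pi, dotsMeasure, integral_fintype_prod_eq_prod fun i t =>
        t ^ a i * (gegenbauer n (p.1 i)).eval t, ← Finset.prod_mul_distrib]
    simp only [dots]
    rw [integral_fintype_prod_eq_prod fun i z => inner ℝ (x i).1 z.1 ^ a i * Y (p.1 i) (p.2 i) z]
    congr! 2 with i
    simpa using integral_eval_inner_mul hn (Polynomial.X ^ a i) (hY.mem (p.1 i) (p.2 i)) (x i)

theorem IsSHBasis.abs_shProd_le (hY : IsSHBasis n Y) (p : SHIndex n d) (x : MS n d) :
    |shProd Y p x| ≤ ‖hY.shCM p‖ :=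
  (hY.shCM p).norm_coe_le_norm x

theorem IsSHBasis.integrable_comp_dots_mul (hn : 2 ≤ n) (hY : IsSHBasis n Y)
    (hg : Integrable g (dotsMeasure n d)) (p : SHIndex n d) (x : MS n d) :
    Integrable (fun z => g (dots x z) * shProd Y p z) (unif n d) :=
  (integrable_comp_dots hn hg x).mul_bdd (hY.continuous_shProd p).aestronglyMeasurable
    (.of_forall (hY.abs_shProd_le p))

theorem IsSHBasis.integral_comp_dots_mul (hn : 2 ≤ n) (hY : IsSHBasis n Y)
    (hg : Integrable g (dotsMeasure n d)) (p : SHIndex n d) (x : MS n d) :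
    ∫ z, g (dots x z) * shProd Y p z ∂(unif n d) = eigval n g p.1 * shProd Y p x := by
  obtain ⟨φ, hφ⟩ :=
    exists_seq_mvPolynomial_tendsto_integral_abs_sub (isCompact_cube d) (ae_mem_cube n d) hg
  have hφi (m : ℕ) : Integrable (fun t => eval t (φ m)) (dotsMeasure n d) :=
    integrable_dotsMeasure_of_continuousOn (continuous_eval (φ m)).continuousOn
  obtain ⟨N, hN⟩ := (isCompact_cube d).exists_bound_of_continuousOn
    (continuous_gegProd (n := n) p.1).continuousOn
  have hsphere : Tendsto (fun m => ∫ z, eval (dots x z) (φ m) * shProd Y p z ∂(unif n d)) atTop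
      (𝓝 (∫ z, g (dots x z) * shProd Y p z ∂(unif n d))) := by
    refine tendsto_integral_mul_of_tendsto_integral_abs_sub
      (fun m => integrable_comp_dots hn (hφi m) x) (integrable_comp_dots hn hg x)
      (hY.continuous_shProd p).aestronglyMeasurable (.of_forall (hY.abs_shProd_le p)) ?_
    refine hφ.congr fun m => ?_
    exact (integral_comp_dots hn (hg.sub (hφi m)).abs.aestronglyMeasurable x).symm
  have hcube : Tendsto (fun m => eigval n (fun t => eval t (φ m)) p.1) atTop
      (𝓝 (eigval n g p.1)) := by
    simp only [eigval_eq_integral]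
    exact tendsto_integral_mul_of_tendsto_integral_abs_sub hφi hg
      (continuous_gegProd p.1).aestronglyMeasurable ((ae_mem_cube n d).mono hN) hφ
  simp only [hY.integral_eval_dots_mul hn] at hsphere
  exact tendsto_nhds_unique hsphere (hcube.mul_const _)

end FunkHecke

/-! ### The Mercer decomposition in `L²` -/

section SquareIntegrable

open Filter Topology

variable {n d : ℕ} {Y : (k : ℕ) → Fin (numHarm n k) → Sph n → ℝ} {g : (Fin d → ℝ) → ℝ}
  {f : MS n d → ℝ}

theorem quasiMeasurePreserving_dots (hn : 2 ≤ n) :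
    Measure.QuasiMeasurePreserving (fun w : MS n d × MS n d => dots w.1 w.2)
      ((unif n d).prod (unif n d)) (dotsMeasure n d) := by
  refine ⟨continuous_dots.measurable, Measure.AbsolutelyContinuous.mk fun s hs h0 => ?_⟩
  rw [Measure.map_apply continuous_dots.measurable hs,
    Measure.measure_prod_null (continuous_dots.measurable hs)]
  refine .of_forall fun x => ?_
  change unif n d (dots x ⁻¹' s) = 0
  rw [(measurePreserving_dots hn x).measure_preimage hs.nullMeasurableSet, h0]

theorem aestronglyMeasurable_comp_dots (hn : 2 ≤ n)
    (hg : AEStronglyMeasurable g (dotsMeasure n d)) :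
    AEStronglyMeasurable (fun w : MS n d × MS n d => g (dots w.1 w.2))
      ((unif n d).prod (unif n d)) :=
  hg.comp_quasiMeasurePreserving (quasiMeasurePreserving_dots hn)

theorem integrable_prod_comp_dots_mul (hn : 2 ≤ n) (hg : Integrable g (dotsMeasure n d))
    (hf : Integrable f (unif n d)) :
    Integrable (fun w : MS n d × MS n d => g (dots w.1 w.2) * f w.2)
      ((unif n d).prod (unif n d)) := by
  rw [integrable_prod_iff' ((aestronglyMeasurable_comp_dots hn hg.aestronglyMeasurable).fun_mul
    hf.aestronglyMeasurable.comp_snd)]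
  have hnorm (z : MS n d) :
      ∫ x, ‖g (dots z x)‖ ∂(unif n d) = ∫ t, ‖g t‖ ∂(dotsMeasure n d) :=
    integral_comp_dots hn hg.norm.aestronglyMeasurable z
  simp only [fun x z : MS n d => dots_comm x z, norm_mul, integral_mul_const, hnorm]
  exact ⟨.of_forall fun z => (integrable_comp_dots hn hg z).mul_const _, hf.norm.const_mul _⟩

theorem IsSHBasis.integral_integral_comp_dots_mul (hn : 2 ≤ n) (hY : IsSHBasis n Y)
    (hg : Integrable g (dotsMeasure n d)) (hf : Integrable f (unif n d)) (p : SHIndex n d) :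
    ∫ x, (∫ z, g (dots x z) * f z ∂(unif n d)) * shProd Y p x ∂(unif n d) =
      eigval n g p.1 * ∫ z, f z * shProd Y p z ∂(unif n d) := by
  have hint : Integrable (fun w : MS n d × MS n d => g (dots w.1 w.2) * f w.2 * shProd Y p w.1)
      ((unif n d).prod (unif n d)) :=
    (integrable_prod_comp_dots_mul hn hg hf).mul_bdd
      ((hY.continuous_shProd p).comp continuous_fst).aestronglyMeasurable
      (.of_forall fun w => hY.abs_shProd_le p w.1)
  have hslice (z : MS n d) : ∫ x, g (dots x z) * f z * shProd Y p x ∂(unif n d) =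
      eigval n g p.1 * (f z * shProd Y p z) := by
    rw [mul_left_comm, ← hY.integral_comp_dots_mul hn hg p z, ← integral_const_mul]
    refine integral_congr_ae (.of_forall fun x => ?_)
    simp only [dots_comm x z]
    ring
  simp only [← integral_mul_const]
  rw [integral_integral_swap hint]
  simp only [hslice, integral_const_mul]

theorem IsSHBasis.shProd_ne_zero (hn : 2 ≤ n) (hY : IsSHBasis n Y) (p : SHIndex n d) :
    shProd Y p ≠ 0 := by
  intro h
  simpa [h] using hY.integral_shProd_mul hn p p

theorem IsSHBasis.isEigenfunction_shProd (hn : 2 ≤ n) (hY : IsSHBasis n Y)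
    (hg : Integrable g (dotsMeasure n d)) (p : SHIndex n d) :
    IsEigenfunction (fun x z => g (dots x z)) (eigval n g p.1) (shProd Y p) :=
  ⟨hY.shProd_ne_zero hn p, fun x =>
    ⟨hY.integrable_comp_dots_mul hn hg p x, hY.integral_comp_dots_mul hn hg p x⟩⟩

theorem IsSHBasis.integral_mul_shProd_eq_zero (hn : 2 ≤ n) (hY : IsSHBasis n Y)
    (hg : Integrable g (dotsMeasure n d)) (hf : Integrable f (unif n d)) {μ : ℝ}
    (hμ : ∀ᵐ x ∂(unif n d), ∫ z, g (dots x z) * f z ∂(unif n d) = μ * f x) {p : SHIndex n d}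
    (hp : eigval n g p.1 ≠ μ) : ∫ x, f x * shProd Y p x ∂(unif n d) = 0 := by
  have hmul : eigval n g p.1 * ∫ x, f x * shProd Y p x ∂(unif n d) =
      μ * ∫ x, f x * shProd Y p x ∂(unif n d) := by
    rw [← hY.integral_integral_comp_dots_mul hn hg hf p, ← integral_const_mul]
    refine integral_congr_ae (hμ.mono fun x hx => ?_)
    simp only [hx, mul_assoc]
  by_contra h
  exact hp (mul_right_cancel₀ h hmul)

theorem IsSHBasis.exists_eq_eigval (hn : 2 ≤ n) (hY : IsSHBasis n Y)
    (hg : Integrable g (dotsMeasure n d)) (hf : MemLp f 2 (unif n d))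
    (hf0 : ¬ f =ᵐ[unif n d] 0) {μ : ℝ}
    (hμ : ∀ᵐ x ∂(unif n d), ∫ z, g (dots x z) * f z ∂(unif n d) = μ * f x) :
    ∃ k, μ = eigval n g k := by
  by_contra! h
  exact hf0 (hY.ae_eq_zero hn hf fun p =>
    hY.integral_mul_shProd_eq_zero hn hg (hf.integrable one_le_two) hμ (h p.1).symm)

theorem norm_sub_sum_inner_smul_sq {ι E : Type*} [NormedAddCommGroup E] [InnerProductSpace ℝ E]
    {v : ι → E} (hv : Orthonormal ℝ v) (x : E) (s : Finset ι) :
    ‖x - ∑ i ∈ s, inner ℝ (v i) x • v i‖ ^ 2 = ‖x‖ ^ 2 - ∑ i ∈ s, inner ℝ (v i) x ^ 2 := by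
  rw [norm_sub_sq_real, ← real_inner_self_eq_norm_sq (∑ i ∈ s, _), hv.inner_sum, inner_sum]
  simp only [inner_smul_right, real_inner_comm (v _) x, conj_trivial, ← sq]
  ring

theorem norm_sq_eq_integral_sq {α : Type*} {m : MeasurableSpace α} {μ : Measure α}
    (u : Lp ℝ 2 μ) : ‖u‖ ^ 2 = ∫ x, u x ^ 2 ∂μ := by
  rw [← real_inner_self_eq_norm_sq, L2.inner_def]
  simp [sq]

theorem tendsto_eLpNorm_two_of_tendsto_integral_sq {α ι : Type*} {m : MeasurableSpace α}
    {μ : Measure α} {l : Filter ι} {F : ι → α → ℝ} (hF : ∀ i, MemLp (F i) 2 μ)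
    (hlim : Tendsto (fun i => ∫ x, F i x ^ 2 ∂μ) l (𝓝 0)) :
    Tendsto (fun i => eLpNorm (F i) 2 μ) l (𝓝 0) := by
  have hsqrt := ENNReal.tendsto_ofReal (hlim.rpow_const (p := 2⁻¹) (Or.inr (by norm_num)))
  rw [Real.zero_rpow (by norm_num), ENNReal.ofReal_zero] at hsqrt
  refine hsqrt.congr fun i => ?_
  rw [(hF i).eLpNorm_eq_integral_rpow_norm two_ne_zero ENNReal.ofNat_ne_top]
  simp

theorem memLp_of_continuous {α : Type*} [TopologicalSpace α] [CompactSpace α] [MeasurableSpace α]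
    [OpensMeasurableSpace α] {μ : Measure α} [IsFiniteMeasure μ] {h : α → ℝ} (hh : Continuous h)
    {r : ENNReal} : MemLp h r μ :=
  hh.memLp_of_hasCompactSupport (HasCompactSupport.of_compactSpace h)

theorem IsSHBasis.inner_shLp_toLp (hY : IsSHBasis n Y) (p : SHIndex n d)
    (hf : MemLp f 2 (unif n d)) :
    inner ℝ (hY.shLp p) (hf.toLp f) = ∫ x, f x * shProd Y p x ∂(unif n d) := by
  rw [hY.inner_shLp]
  refine integral_congr_ae ?_
  filter_upwards [hf.coeFn_toLp] with x hx
  rw [hx]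

theorem norm_toLp_sq {α : Type*} {m : MeasurableSpace α} {μ : Measure α} {h : α → ℝ}
    (hh : MemLp h 2 μ) : ‖hh.toLp h‖ ^ 2 = ∫ x, h x ^ 2 ∂μ := by
  rw [norm_sq_eq_integral_sq]
  exact integral_congr_ae (hh.coeFn_toLp.pow_const 2)

theorem IsSHBasis.hasSum_sq (hn : 2 ≤ n) (hY : IsSHBasis n Y) (hf : MemLp f 2 (unif n d)) :
    HasSum (fun p : SHIndex n d => (∫ x, f x * shProd Y p x ∂(unif n d)) ^ 2)
      (∫ x, f x ^ 2 ∂(unif n d)) := by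
  have h := (hY.hilbertBasis hn).hasSum_inner_mul_inner (hf.toLp f) (hf.toLp f)
  rw [real_inner_self_eq_norm_sq, norm_toLp_sq, hY.coe_hilbertBasis hn] at h
  refine h.congr_fun fun p => ?_
  rw [real_inner_comm, hY.inner_shLp_toLp p hf, sq]

theorem IsSHBasis.integral_sub_sum_sq (hn : 2 ≤ n) (hY : IsSHBasis n Y)
    (hf : MemLp f 2 (unif n d)) (s : Finset (SHIndex n d)) :
    ∫ x, (f x - ∑ p ∈ s, (∫ z, f z * shProd Y p z ∂(unif n d)) * shProd Y p x) ^ 2 ∂(unif n d) =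
      ∫ x, f x ^ 2 ∂(unif n d) - ∑ p ∈ s, (∫ z, f z * shProd Y p z ∂(unif n d)) ^ 2 := by
  have h := norm_sub_sum_inner_smul_sq (hY.orthonormal_shLp hn) (hf.toLp f) s
  simp only [hY.inner_shLp_toLp _ hf, norm_toLp_sq, norm_sq_eq_integral_sq (_ - _)] at h
  rw [← h]
  refine integral_congr_ae ?_
  filter_upwards [hf.coeFn_toLp, Lp.coeFn_sub (hf.toLp f)
      (∑ p ∈ s, (∫ z, f z * shProd Y p z ∂(unif n d)) • hY.shLp p),
    Lp.coeFn_finsetSum s fun p => (∫ z, f z * shProd Y p z ∂(unif n d)) • hY.shLp p,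
    ae_all_iff.2 hY.coeFn_shLp,
    ae_all_iff.2 fun p => Lp.coeFn_smul (∫ z, f z * shProd Y p z ∂(unif n d)) (hY.shLp p)]
    with x hfx hsub hsum hYx hsmul
  simp only [hsub, Pi.sub_apply, hfx, hsum, Finset.sum_apply, hsmul, Pi.smul_apply, hYx,
    smul_eq_mul]

theorem memLp_comp_dots (hn : 2 ≤ n) (hg : AEStronglyMeasurable g (dotsMeasure n d))
    (hg2 : Integrable (fun t => g t ^ 2) (dotsMeasure n d)) (x : MS n d) :
    MemLp (fun z => g (dots x z)) 2 (unif n d) :=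
  (memLp_two_iff_integrable_sq (hg.comp_measurePreserving (measurePreserving_dots hn x))).2
    (integrable_comp_dots hn hg2 x)

theorem memLp_prod_comp_dots (hn : 2 ≤ n) (hg : AEStronglyMeasurable g (dotsMeasure n d))
    (hg2 : Integrable (fun t => g t ^ 2) (dotsMeasure n d)) :
    MemLp (fun w : MS n d × MS n d => g (dots w.1 w.2)) 2 ((unif n d).prod (unif n d)) := by
  rw [memLp_two_iff_integrable_sq (aestronglyMeasurable_comp_dots hn hg)]
  simpa only [mul_one] using
    integrable_prod_comp_dots_mul hn hg2 (integrable_const (μ := unif n d) (1 : ℝ))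

theorem IsSHBasis.memLp_sub_sum (hn : 2 ≤ n) (hY : IsSHBasis n Y)
    (hg : AEStronglyMeasurable g (dotsMeasure n d))
    (hg2 : Integrable (fun t => g t ^ 2) (dotsMeasure n d)) (c : SHIndex n d → ℝ)
    (s : Finset (SHIndex n d)) :
    MemLp (fun w : MS n d × MS n d =>
      g (dots w.1 w.2) - ∑ p ∈ s, c p * shProd Y p w.1 * shProd Y p w.2) 2
      ((unif n d).prod (unif n d)) := by
  have := hY.continuous_shProd (d := d)
  exact (memLp_prod_comp_dots hn hg hg2).sub (memLp_of_continuous (by fun_prop))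

theorem IsSHBasis.integral_comp_dots_sub_sum_sq (hn : 2 ≤ n) (hY : IsSHBasis n Y)
    (hg : Integrable g (dotsMeasure n d)) (hg2 : Integrable (fun t => g t ^ 2) (dotsMeasure n d))
    (s : Finset (SHIndex n d)) (x : MS n d) :
    ∫ z, (g (dots x z) - ∑ p ∈ s, eigval n g p.1 * shProd Y p x * shProd Y p z) ^ 2 ∂(unif n d) =
      ∫ t, g t ^ 2 ∂(dotsMeasure n d) - ∑ p ∈ s, (eigval n g p.1 * shProd Y p x) ^ 2 := by
  have h := hY.integral_sub_sum_sq hn (memLp_comp_dots hn hg.aestronglyMeasurable hg2 x) s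
  simpa only [integral_comp_dots hn hg2.aestronglyMeasurable x,
    hY.integral_comp_dots_mul hn hg] using h

theorem IsSHBasis.hasSum_eigval_mul_shProd_sq (hn : 2 ≤ n) (hY : IsSHBasis n Y)
    (hg : Integrable g (dotsMeasure n d)) (hg2 : Integrable (fun t => g t ^ 2) (dotsMeasure n d))
    (x : MS n d) :
    HasSum (fun p : SHIndex n d => (eigval n g p.1 * shProd Y p x) ^ 2)
      (∫ t, g t ^ 2 ∂(dotsMeasure n d)) := by
  have h := hY.hasSum_sq hn (memLp_comp_dots hn hg.aestronglyMeasurable hg2 x)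
  rw [integral_comp_dots hn hg2.aestronglyMeasurable x] at h
  simpa only [hY.integral_comp_dots_mul hn hg] using h

theorem IsSHBasis.tendsto_eLpNorm_sub_sum (hn : 2 ≤ n) (hY : IsSHBasis n Y)
    (hg : Integrable g (dotsMeasure n d))
    (hg2 : Integrable (fun t => g t ^ 2) (dotsMeasure n d)) :
    Tendsto (fun s : Finset (SHIndex n d) => eLpNorm (fun w : MS n d × MS n d =>
        g (dots w.1 w.2) - ∑ p ∈ s, eigval n g p.1 * shProd Y p w.1 * shProd Y p w.2) 2
      ((unif n d).prod (unif n d))) atTop (𝓝 0) := by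
  have hmem := hY.memLp_sub_sum hn hg.aestronglyMeasurable hg2 fun p => eigval n g p.1
  refine tendsto_eLpNorm_two_of_tendsto_integral_sq hmem ?_
  simp only [fun s => integral_prod _ (hmem s).integrable_sq,
    hY.integral_comp_dots_sub_sum_sq hn hg hg2]
  have hHasSum := hY.hasSum_eigval_mul_shProd_sq hn hg hg2
  have hlim (x : MS n d) : Tendsto (fun s => ∫ t, g t ^ 2 ∂(dotsMeasure n d) -
      ∑ p ∈ s, (eigval n g p.1 * shProd Y p x) ^ 2) atTop (𝓝 0) := by
    rw [← sub_self (∫ t, g t ^ 2 ∂(dotsMeasure n d))]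
    exact (hHasSum x).const_sub _
  have hbound (s : Finset (SHIndex n d)) (x : MS n d) : ‖∫ t, g t ^ 2 ∂(dotsMeasure n d) -
      ∑ p ∈ s, (eigval n g p.1 * shProd Y p x) ^ 2‖ ≤ ∫ t, g t ^ 2 ∂(dotsMeasure n d) := by
    rw [Real.norm_of_nonneg (sub_nonneg.2 (sum_le_hasSum s (fun _ _ => sq_nonneg _) (hHasSum x)))]
    exact sub_le_self _ (Finset.sum_nonneg fun _ _ => sq_nonneg _)
  have hcont (s : Finset (SHIndex n d)) : Continuous fun x : MS n d =>
      ∫ t, g t ^ 2 ∂(dotsMeasure n d) - ∑ p ∈ s, (eigval n g p.1 * shProd Y p x) ^ 2 := by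
    have := hY.continuous_shProd (d := d)
    fun_prop
  simpa only [integral_zero] using tendsto_integral_filter_of_dominated_convergence _
    (.of_forall fun s => (hcont s).aestronglyMeasurable)
    (.of_forall fun s => .of_forall (hbound s)) (integrable_const _) (.of_forall hlim)

end SquareIntegrable

/-! ### Uniform convergence -/

section UniformConvergence

open Filter Topology

variable {n d : ℕ} {Y : (k : ℕ) → Fin (numHarm n k) → Sph n → ℝ} {g : (Fin d → ℝ) → ℝ}

/-- The value of `∑ j, Y_{k,j}(x)²`, which the addition theorem shows to be independent of `x`. -/
def sumSq (n : ℕ) (k : Fin d → ℕ) : ℝ := ∏ i, (gegNorm n (k i))⁻¹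

theorem IsSHBasis.sumSq_pos (hn : 2 ≤ n) (hY : IsSHBasis n Y) (k : Fin d → ℕ) : 0 < sumSq n k :=
  Finset.prod_pos fun _ _ => inv_pos.2 (hY.gegNorm_pos hn _)

theorem IsSHBasis.sum_shProd_sq (hn : 2 ≤ n) (hY : IsSHBasis n Y) (k : Fin d → ℕ) (x : MS n d) :
    ∑ j : (i : Fin d) → Fin (numHarm n (k i)), shProd Y ⟨k, j⟩ x ^ 2 = sumSq n k := by
  simp only [sumSq, shProd, ← Finset.prod_pow]
  rw [← Finset.prod_congr rfl fun i _ => hY.sum_sq hn (k i) (x i), Finset.prod_univ_sum,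
    Fintype.piFinset_univ]

theorem IsSHBasis.sum_mul_shProd_sq_le (hn : 2 ≤ n) (hY : IsSHBasis n Y) {c : (Fin d → ℕ) → ℝ}
    (hc : ∀ k, 0 ≤ c k) (t : Finset (SHIndex n d)) (x : MS n d) :
    ∑ p ∈ t, c p.1 * shProd Y p x ^ 2 ≤ ∑ k ∈ t.image Sigma.fst, c k * sumSq n k := by
  have hsub : t ⊆ (t.image Sigma.fst).sigma fun _ => Finset.univ := fun p hp =>
    Finset.mem_sigma.2 ⟨Finset.mem_image_of_mem _ hp, Finset.mem_univ _⟩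
  refine (Finset.sum_le_sum_of_subset_of_nonneg hsub fun p _ _ =>
    mul_nonneg (hc p.1) (sq_nonneg _)).trans_eq ?_
  simp only [Finset.sum_sigma, ← Finset.mul_sum, hY.sum_shProd_sq hn]

/-- The term `c_k Y_{k,j}(x) Y_{k,j}(z)` of a multi-dot product expansion. -/
def IsSHBasis.termCM (hY : IsSHBasis n Y) (c : (Fin d → ℕ) → ℝ) (p : SHIndex n d) :
    C(MS n d × MS n d, ℝ) where
  toFun w := c p.1 * shProd Y p w.1 * shProd Y p w.2
  continuous_toFun := by
    have := hY.continuous_shProd p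
    fun_prop

theorem IsSHBasis.sum_abs_termCM_le (hn : 2 ≤ n) (hY : IsSHBasis n Y) (c : (Fin d → ℕ) → ℝ)
    (t : Finset (SHIndex n d)) (w : MS n d × MS n d) :
    ∑ p ∈ t, |hY.termCM c p w| ≤ ∑ k ∈ t.image Sigma.fst, |c k| * sumSq n k := by
  have hterm (p : SHIndex n d) : |hY.termCM c p w| ≤
      (|c p.1| * shProd Y p w.1 ^ 2 + |c p.1| * shProd Y p w.2 ^ 2) / 2 := by
    have hamgm := two_mul_le_add_sq |shProd Y p w.1| |shProd Y p w.2|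
    rw [sq_abs, sq_abs] at hamgm
    calc |hY.termCM c p w| = |c p.1| * (|shProd Y p w.1| * |shProd Y p w.2|) := by
          simp only [termCM, ContinuousMap.coe_mk, abs_mul, mul_assoc]
      _ ≤ |c p.1| * ((shProd Y p w.1 ^ 2 + shProd Y p w.2 ^ 2) / 2) := by
          gcongr
          linarith
      _ = _ := by ring
  calc ∑ p ∈ t, |hY.termCM c p w|
      ≤ (∑ p ∈ t, |c p.1| * shProd Y p w.1 ^ 2 + ∑ p ∈ t, |c p.1| * shProd Y p w.2 ^ 2) / 2 := by
        rw [← Finset.sum_add_distrib, Finset.sum_div]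
        exact Finset.sum_le_sum fun p _ => hterm p
    _ ≤ _ := by
        linarith [hY.sum_mul_shProd_sq_le hn (fun k => abs_nonneg (c k)) t w.1,
          hY.sum_mul_shProd_sq_le hn (fun k => abs_nonneg (c k)) t w.2]

theorem IsSHBasis.summable_termCM (hn : 2 ≤ n) (hY : IsSHBasis n Y) {c : (Fin d → ℕ) → ℝ}
    (hc : Summable fun k => |c k| * sumSq n k) : Summable (hY.termCM c) := by
  rw [summable_iff_vanishing_norm] at hc ⊢
  intro ε hε
  obtain ⟨F, hF⟩ := hc ε hε
  refine ⟨F.sigma fun _ => Finset.univ, fun t ht => ?_⟩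
  have hdisj : Disjoint (t.image Sigma.fst) F := by
    simp only [Finset.disjoint_left, Finset.mem_sigma, Finset.mem_univ, and_true] at ht
    simpa only [Finset.disjoint_left, Finset.forall_mem_image] using ht
  refine (ContinuousMap.norm_lt_iff _ hε).2 fun w => ?_
  calc ‖(∑ p ∈ t, hY.termCM c p) w‖ ≤ ∑ p ∈ t, |hY.termCM c p w| := by
        rw [ContinuousMap.sum_apply]
        exact norm_sum_le _ _
    _ ≤ ∑ k ∈ t.image Sigma.fst, |c k| * sumSq n k := hY.sum_abs_termCM_le hn c t w
    _ < ε := (le_abs_self _).trans_lt (hF _ hdisj)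

theorem continuous_comp_dots (hg : ContinuousOn g (cube d)) :
    Continuous fun w : MS n d × MS n d => g (dots w.1 w.2) :=
  hg.comp_continuous continuous_dots fun w => dots_mem_cube w.1 w.2

theorem IsSHBasis.tendstoUniformly (hn : 2 ≤ n) (hY : IsSHBasis n Y) (hg : ContinuousOn g (cube d))
    (hs : Summable fun k => |eigval n g k| * sumSq n k) :
    TendstoUniformly
      (fun (s : Finset (SHIndex n d)) (w : MS n d × MS n d) =>
        ∑ p ∈ s, eigval n g p.1 * shProd Y p w.1 * shProd Y p w.2)
      (fun w => g (dots w.1 w.2)) atTop := by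
  let ν : Measure (MS n d × MS n d) := (unif n d).prod (unif n d)
  let kernel : C(MS n d × MS n d, ℝ) := ⟨_, continuous_comp_dots hg⟩
  obtain ⟨G, hG⟩ := hY.summable_termCM hn hs
  have hL2 : Tendsto (fun s : Finset (SHIndex n d) =>
      ContinuousMap.toLp 2 ν ℝ (∑ p ∈ s, hY.termCM (eigval n g) p)) atTop
      (𝓝 (ContinuousMap.toLp 2 ν ℝ kernel)) := by
    rw [tendsto_iff_edist_tendsto_0]
    refine (hY.tendsto_eLpNorm_sub_sum hn (integrable_dotsMeasure_of_continuousOn hg)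
      (integrable_dotsMeasure_of_continuousOn (hg.pow 2))).congr fun s => ?_
    rw [edist_comm, edist_eq_enorm_sub, ← map_sub, Lp.enorm_def,
      eLpNorm_congr_ae (ContinuousMap.coeFn_toLp ν _)]
    refine eLpNorm_congr_ae (.of_forall fun w => ?_)
    simp only [ContinuousMap.sub_apply, ContinuousMap.sum_apply, termCM, kernel,
      ContinuousMap.coe_mk]
  have hGeq : G = kernel := ContinuousMap.toLp_injective ν (𝕜 := ℝ) (p := 2)
    (tendsto_nhds_unique (((ContinuousMap.toLp 2 ν ℝ).continuous.tendsto G).comp hG) hL2)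
  have hunif := ContinuousMap.tendsto_iff_tendstoUniformly.1 (hGeq ▸ hG)
  simp only [ContinuousMap.coe_sum, Finset.sum_apply] at hunif
  exact hunif

end UniformConvergence

/-! ### Positive semidefinite kernels -/

section PosSemidef

open Filter Topology

theorem integral_simpleFunc_comp_mul {X Z : Type*} [MeasurableSpace X] {μ : Measure X}
    (π : SimpleFunc X Z) (F : Z → ℝ) {f : X → ℝ} (hf : Integrable f μ) :
    ∫ x, F (π x) * f x ∂μ = ∑ a ∈ π.range, F a * ∫ x in π ⁻¹' {a}, f x ∂μ := by
  have hcongr (a : Z) : Set.EqOn (fun x => F a * f x) (fun x => F (π x) * f x) (π ⁻¹' {a}) :=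
    fun x (hx : π x = a) => by simp only [hx]
  have hcover : ⋃ a ∈ π.range, π ⁻¹' {a} = Set.univ :=
    Set.eq_univ_of_forall fun x => Set.mem_iUnion₂.2 ⟨π x, π.mem_range_self x, rfl⟩
  rw [← setIntegral_univ, ← hcover, integral_biUnion_finset _
    (fun a _ => π.measurableSet_preimage {a})
    (fun a _ b _ hab => Disjoint.preimage _ (Set.disjoint_singleton.2 hab))
    fun a _ => (integrableOn_congr_fun (hcongr a) (π.measurableSet_preimage {a})).1
      (hf.const_mul (F a)).integrableOn]
  refine Finset.sum_congr rfl fun a _ => ?_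
  rw [← integral_const_mul, setIntegral_congr_fun (π.measurableSet_preimage {a}) (hcongr a)]

theorem integral_integral_simpleFunc_comp_nonneg {X Z : Type*} [MeasurableSpace X] {μ : Measure X}
    {K : Z → Z → ℝ} (hK : (Matrix.of K).PosSemidef) (π : SimpleFunc X Z) {f : X → ℝ}
    (hf : Integrable f μ) :
    0 ≤ ∫ x, (∫ z, K (π x) (π z) * f z ∂μ) * f x ∂μ := by
  rw [integral_simpleFunc_comp_mul π (fun a => ∫ z, K a (π z) * f z ∂μ) hf]
  simp only [integral_simpleFunc_comp_mul π (K _) hf]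
  have hmem (a : Z) (ha : ∫ x in π ⁻¹' {a}, f x ∂μ ≠ 0) : a ∈ π.range := by
    contrapose! ha
    rw [SimpleFunc.preimage_eq_empty_iff π a |>.2 ha, setIntegral_empty]
  refine (hK.2 (Finsupp.onFinset π.range (fun a => ∫ x in π ⁻¹' {a}, f x ∂μ) hmem)).trans_eq ?_
  simp only [star_trivial, Matrix.of_apply]
  rw [Finsupp.onFinset_sum _ (by simp)]
  refine Finset.sum_congr rfl fun a _ => ?_
  rw [Finsupp.onFinset_sum _ (by simp), Finset.sum_mul]
  exact Finset.sum_congr rfl fun b _ => by ring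

theorem posSemidef_gram {ι E : Type*} [NormedAddCommGroup E] [InnerProductSpace ℝ E] (v : ι → E) :
    (Matrix.gram ℝ v).PosSemidef := by
  refine ⟨Matrix.isHermitian_gram ℝ v, fun x => ?_⟩
  refine real_inner_self_nonneg (x := x.sum fun i a => a • v i).trans_eq ?_
  simp only [Finsupp.sum_inner, Finsupp.inner_sum, real_inner_smul_left, real_inner_smul_right,
    star_trivial, Matrix.gram_apply]
  exact Finsupp.sum_congr fun i _ => Finsupp.sum_congr fun j _ => by
    rw [real_inner_comm]
    ring

theorem posSemidef_prod {ι σ : Type*} (s : Finset σ) {A : σ → ι → ι → ℝ}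
    (hA : ∀ i ∈ s, (Matrix.of (A i)).PosSemidef) :
    (Matrix.of fun x z => ∏ i ∈ s, A i x z).PosSemidef := by
  classical
  induction s using Finset.induction_on with
  | empty => simpa [Matrix.gram] using posSemidef_gram fun _ : ι => (1 : ℝ)
  | insert i s hi ih =>
    have hprod : (Matrix.of fun x z => ∏ j ∈ insert i s, A j x z) =
        (Matrix.of (A i)).hadamard (Matrix.of fun x z => ∏ j ∈ s, A j x z) :=
      Matrix.ext fun _ _ => Finset.prod_insert hi
    rw [hprod]
    exact (hA i (Finset.mem_insert_self i s)).hadamard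
      (ih fun j hj => hA j (Finset.mem_insert_of_mem hj))

theorem integral_integral_mul_nonneg_of_posSemidef {X : Type*} [PseudoEMetricSpace X]
    [CompactSpace X] [MeasurableSpace X] [BorelSpace X] {μ : Measure X}
    {K : X → X → ℝ} (hK : (Matrix.of K).PosSemidef)
    (hKc : Continuous fun w : X × X => K w.1 w.2) {f : X → ℝ} (hf : Integrable f μ) :
    0 ≤ ∫ x, (∫ z, K x z * f z ∂μ) * f x ∂μ := by
  cases isEmpty_or_nonempty X
  · rw [integral_of_isEmpty]
  obtain ⟨x₀⟩ := ‹Nonempty X›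
  let π (N : ℕ) : SimpleFunc X X := SimpleFunc.approxOn id measurable_id Set.univ x₀ trivial N
  have hπ (x : X) : Tendsto (fun N => π N x) atTop (𝓝 x) :=
    SimpleFunc.tendsto_approxOn measurable_id (Set.mem_univ x₀) (by simp)
  obtain ⟨B, hB⟩ := isCompact_univ.exists_bound_of_continuousOn hKc.continuousOn
  have hbound (x z : X) (y : X) : ‖K x z * f y‖ ≤ B * ‖f y‖ := by
    rw [norm_mul]
    exact mul_le_mul_of_nonneg_right (hB (x, z) trivial) (norm_nonneg _)
  have hmeas (N : ℕ) (x : X) : AEStronglyMeasurable (fun z => K (π N x) (π N z) * f z) μ :=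
    ((π N).map (K (π N x))).aestronglyMeasurable.mul hf.aestronglyMeasurable
  have hinner (x : X) : Tendsto (fun N => ∫ z, K (π N x) (π N z) * f z ∂μ) atTop
      (𝓝 (∫ z, K x z * f z ∂μ)) :=
    tendsto_integral_of_dominated_convergence _ (hmeas · x) (hf.norm.const_mul B)
      (fun N => .of_forall fun z => hbound _ _ z)
      (.of_forall fun z => ((hKc.tendsto (x, z)).comp ((hπ x).prodMk_nhds (hπ z))).mul_const _)
  have houter : Tendsto (fun N => ∫ x, (∫ z, K (π N x) (π N z) * f z ∂μ) * f x ∂μ) atTop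
      (𝓝 (∫ x, (∫ z, K x z * f z ∂μ) * f x ∂μ)) := by
    refine tendsto_integral_of_dominated_convergence (fun x => (B * ∫ z, ‖f z‖ ∂μ) * ‖f x‖)
      (fun N => ?_) (hf.norm.const_mul _) (fun N => .of_forall fun x => ?_)
      (.of_forall fun x => (hinner x).mul_const _)
    · exact ((π N).map fun a => ∫ z, K a (π N z) * f z ∂μ).aestronglyMeasurable.mul
        hf.aestronglyMeasurable
    · rw [norm_mul, ← integral_const_mul]
      gcongr
      exact norm_integral_le_of_norm_le (hf.norm.const_mul B) (.of_forall fun z => hbound _ _ z)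
  exact ge_of_tendsto' houter fun N => integral_integral_simpleFunc_comp_nonneg hK (π N) hf

theorem continuous_integral_mul {X Z : Type*} [TopologicalSpace X] [CompactSpace X]
    [FirstCountableTopology X] [TopologicalSpace Z] [CompactSpace Z] [MeasurableSpace Z]
    [OpensMeasurableSpace Z] {μ : Measure Z} {K : X → Z → ℝ}
    (hK : Continuous fun w : X × Z => K w.1 w.2) {f : Z → ℝ} (hf : Integrable f μ) :
    Continuous fun x => ∫ z, K x z * f z ∂μ := by
  obtain ⟨B, hB⟩ := isCompact_univ.exists_bound_of_continuousOn hK.continuousOn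
  refine continuous_of_dominated (bound := fun z => B * ‖f z‖) (fun x => ?_)
    (fun x => .of_forall fun z => ?_) (hf.norm.const_mul _) (.of_forall fun z => ?_)
  · exact (hK.comp (Continuous.prodMk_right x)).aestronglyMeasurable.mul hf.aestronglyMeasurable
  · rw [norm_mul]
    exact mul_le_mul_of_nonneg_right (hB (x, z) trivial) (norm_nonneg _)
  · exact (hK.comp (Continuous.prodMk_left z)).mul continuous_const

theorem nonneg_diag_of_setIntegral_nonneg {X : Type*} [TopologicalSpace X] [CompactSpace X]
    [SecondCountableTopology X] [MeasurableSpace X] [BorelSpace X] {μ : Measure X}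
    [IsFiniteMeasure μ] [μ.IsOpenPosMeasure] {R : X × X → ℝ} (hR : Continuous R)
    (hint : ∀ U, IsOpen U → 0 ≤ ∫ w in U ×ˢ U, R w ∂(μ.prod μ)) (x : X) : 0 ≤ R (x, x) := by
  by_contra! hneg
  obtain ⟨c, hRc, hc⟩ := exists_between hneg
  have hnhds : {w | R w < c} ∈ 𝓝 (x, x) := (isOpen_lt hR continuous_const).mem_nhds hRc
  rw [nhds_prod_eq, mem_prod_same_iff] at hnhds
  obtain ⟨V, hV, hVR⟩ := hnhds
  obtain ⟨U, hUV, hU, hxU⟩ := mem_nhds_iff.1 hV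
  have hpos : 0 < (μ.prod μ).real (U ×ˢ U) :=
    ENNReal.toReal_pos ((hU.prod hU).measure_pos _ ⟨(x, x), hxU, hxU⟩).ne' (measure_ne_top _ _)
  have hle : ∫ w in U ×ˢ U, R w ∂(μ.prod μ) ≤ (μ.prod μ).real (U ×ˢ U) * c := by
    rw [← smul_eq_mul, ← setIntegral_const]
    exact setIntegral_mono_on (integrable_of_continuous hR).integrableOn
      (integrable_const c).integrableOn (hU.prod hU).measurableSet
      fun w hw => (hVR (Set.prod_mono hUV hUV hw)).le
  exact ((hint U hU).trans hle).not_gt (mul_neg_of_pos_of_neg hpos hc)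

variable {n d : ℕ} {Y : (k : ℕ) → Fin (numHarm n k) → Sph n → ℝ} {g : (Fin d → ℝ) → ℝ}
  {f : MS n d → ℝ}

theorem IsSHBasis.eigval_nonneg (hn : 2 ≤ n) (hY : IsSHBasis n Y) (hg : ContinuousOn g (cube d))
    (hpsd : (Matrix.of fun x z : MS n d => g (dots x z)).PosSemidef) (k : Fin d → ℕ) :
    0 ≤ eigval n g k := by
  obtain ⟨σ⟩ := nonempty_sph (n := n) (by omega)
  obtain ⟨j, -⟩ := Finset.nonempty_of_sum_ne_zero
    ((hY.sum_shProd_sq hn k fun _ => σ).trans_ne (hY.sumSq_pos hn k).ne')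
  have hYj := integrable_of_continuous (μ := unif n d) (hY.continuous_shProd ⟨k, j⟩)
  calc 0 ≤ ∫ x, (∫ z, g (dots x z) * shProd Y ⟨k, j⟩ z ∂(unif n d)) * shProd Y ⟨k, j⟩ x
        ∂(unif n d) :=
        integral_integral_mul_nonneg_of_posSemidef hpsd (continuous_comp_dots hg) hYj
    _ = eigval n g k := by
        rw [hY.integral_integral_comp_dots_mul hn (integrable_dotsMeasure_of_continuousOn hg) hYj,
          hY.integral_shProd_mul hn, if_pos rfl, mul_one]

theorem IsSHBasis.hasSum_eigval_mul_sq (hn : 2 ≤ n) (hY : IsSHBasis n Y)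
    (hg : ContinuousOn g (cube d)) (hf : MemLp f 2 (unif n d)) :
    HasSum (fun p : SHIndex n d => eigval n g p.1 * (∫ x, f x * shProd Y p x ∂(unif n d)) ^ 2)
      (∫ x, (∫ z, g (dots x z) * f z ∂(unif n d)) * f x ∂(unif n d)) := by
  have hfi : Integrable f (unif n d) := hf.integrable one_le_two
  have hT : MemLp (fun x => ∫ z, g (dots x z) * f z ∂(unif n d)) 2 (unif n d) :=
    memLp_of_continuous (continuous_integral_mul (continuous_comp_dots hg) hfi)
  have hparseval := (hY.hilbertBasis hn).hasSum_inner_mul_inner (hT.toLp _) (hf.toLp f)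
  have hinner : inner ℝ (hT.toLp _) (hf.toLp f) =
      ∫ x, (∫ z, g (dots x z) * f z ∂(unif n d)) * f x ∂(unif n d) := by
    rw [L2.inner_def]
    refine integral_congr_ae ?_
    filter_upwards [hT.coeFn_toLp, hf.coeFn_toLp] with x hTx hfx
    rw [hTx, hfx, Real.inner_apply]
  rw [hY.coe_hilbertBasis hn, hinner] at hparseval
  refine hparseval.congr_fun fun p => ?_
  rw [real_inner_comm, hY.inner_shLp_toLp p hT, hY.inner_shLp_toLp p hf,
    hY.integral_integral_comp_dots_mul hn (integrable_dotsMeasure_of_continuousOn hg) hfi]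
  ring

theorem IsSHBasis.hasSum_eigval_mul_setIntegral_sq (hn : 2 ≤ n) (hY : IsSHBasis n Y)
    (hg : ContinuousOn g (cube d)) {U : Set (MS n d)} (hU : MeasurableSet U) :
    HasSum (fun p : SHIndex n d => eigval n g p.1 * (∫ x in U, shProd Y p x ∂(unif n d)) ^ 2)
      (∫ w in U ×ˢ U, g (dots w.1 w.2) ∂((unif n d).prod (unif n d))) := by
  have hind (h : MS n d → ℝ) :
      ∫ x, h x * U.indicator 1 x ∂(unif n d) = ∫ x in U, h x ∂(unif n d) := by
    rw [← integral_indicator hU]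
    refine integral_congr_ae (.of_forall fun x => ?_)
    by_cases hx : x ∈ U <;> simp [hx]
  have h := hY.hasSum_eigval_mul_sq hn hg (memLp_indicator_const 2 hU 1 (.inr (measure_ne_top _ _)))
  rw [setIntegral_prod _ (integrable_of_continuous (continuous_comp_dots hg)).integrableOn]
  simpa only [← Pi.one_def, mul_comm (U.indicator _ _), hind] using h

theorem IsSHBasis.sum_eigval_mul_sq_le (hn : 2 ≤ n) (hY : IsSHBasis n Y)
    (hg : ContinuousOn g (cube d))
    (hpsd : (Matrix.of fun x z : MS n d => g (dots x z)).PosSemidef) (s : Finset (SHIndex n d))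
    (x : MS n d) : ∑ p ∈ s, eigval n g p.1 * shProd Y p x ^ 2 ≤ g (dots x x) := by
  have hterm (p : SHIndex n d) : Continuous fun w : MS n d × MS n d =>
      eigval n g p.1 * (shProd Y p w.1 * shProd Y p w.2) := by
    have := hY.continuous_shProd p
    fun_prop
  have hsum := continuous_finsetSum s fun p _ => hterm p
  simp only [sq]
  rw [← sub_nonneg]
  refine nonneg_diag_of_setIntegral_nonneg (μ := unif n d)
    ((continuous_comp_dots hg).fun_sub hsum) (fun U hU => ?_) x
  rw [integral_sub (integrable_of_continuous (continuous_comp_dots hg)).integrableOn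
      (integrable_of_continuous hsum).integrableOn,
    integral_finsetSum _ fun p _ => (integrable_of_continuous (hterm p)).integrableOn]
  simp only [integral_const_mul, setIntegral_prod_mul, ← sq]
  exact sub_nonneg.2 (sum_le_hasSum s
    (fun p _ => mul_nonneg (hY.eigval_nonneg hn hg hpsd p.1) (sq_nonneg _))
    (hY.hasSum_eigval_mul_setIntegral_sq hn hg hU.measurableSet))

theorem IsSHBasis.sum_eigval_mul_sumSq_le (hn : 2 ≤ n) (hY : IsSHBasis n Y)
    (hg : ContinuousOn g (cube d))
    (hpsd : (Matrix.of fun x z : MS n d => g (dots x z)).PosSemidef) (F : Finset (Fin d → ℕ))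
    (x : MS n d) : ∑ k ∈ F, eigval n g k * sumSq n k ≤ g (dots x x) := by
  have h := hY.sum_eigval_mul_sq_le hn hg hpsd (F.sigma fun _ => Finset.univ) x
  simpa only [Finset.sum_sigma, ← Finset.mul_sum, hY.sum_shProd_sq hn] using h

theorem IsSHBasis.summable_of_posSemidef (hn : 2 ≤ n) (hY : IsSHBasis n Y)
    (hg : ContinuousOn g (cube d))
    (hpsd : (Matrix.of fun x z : MS n d => g (dots x z)).PosSemidef) :
    Summable fun k : Fin d → ℕ => |eigval n g k| * sumSq n k := by
  obtain ⟨σ⟩ := nonempty_sph (n := n) (by omega)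
  simp only [abs_of_nonneg (hY.eigval_nonneg hn hg hpsd _)]
  exact summable_of_sum_le
    (fun k => mul_nonneg (hY.eigval_nonneg hn hg hpsd k) (hY.sumSq_pos hn k).le)
    fun F => hY.sum_eigval_mul_sumSq_le hn hg hpsd F fun _ => σ

end PosSemidef

/-! ### Power series -/

section PowerSeries

theorem abs_prod_pow_le_one {d : ℕ} {t : Fin d → ℝ} (ht : t ∈ cube d) (m : Fin d → ℕ) :
    |∏ i, t i ^ m i| ≤ 1 := by
  simp only [Finset.abs_prod, abs_pow]
  exact Finset.prod_le_one (fun i _ => pow_nonneg (abs_nonneg _) _)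
    fun i _ => pow_le_one₀ (abs_nonneg _) (abs_le.2 (mem_cube.1 ht i))

theorem continuous_prod_pow {d : ℕ} (m : Fin d → ℕ) :
    Continuous fun t : Fin d → ℝ => ∏ i, t i ^ m i := by
  fun_prop

theorem posSemidef_prod_pow_dots {n d : ℕ} (m : Fin d → ℕ) :
    (Matrix.of fun x z : MS n d => ∏ i, dots x z i ^ m i).PosSemidef := by
  refine posSemidef_prod Finset.univ fun i _ => ?_
  simpa only [Matrix.gram, Matrix.of_apply, dots, Finset.prod_const, Finset.card_range] using
    posSemidef_prod (Finset.range (m i)) fun _ _ => posSemidef_gram fun x : MS n d => (x i).1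

theorem summable_of_hasSum_mul {α β : Type*} {b : α → ℝ} {a : α → β → ℝ} {c : β → ℝ} {C : ℝ}
    (hb : Summable b) (ha : ∀ m k, 0 ≤ a m k) (haC : ∀ m (s : Finset β), ∑ k ∈ s, a m k ≤ C)
    (hc : ∀ k, HasSum (fun m => b m * a m k) (c k)) : Summable c := by
  have hsum (m : α) : Summable (a m) := summable_of_sum_le (ha m) (haC m)
  have hnorm (m : α) (k : β) : ‖b m * a m k‖ = |b m| * a m k := by
    rw [norm_mul, Real.norm_eq_abs, Real.norm_of_nonneg (ha m k)]
  have hprod : Summable fun q : α × β => b q.1 * a q.1 q.2 := by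
    refine .of_norm ((summable_prod_of_nonneg fun _ => norm_nonneg _).2 ⟨fun m => ?_, ?_⟩)
    · simpa only [hnorm] using (hsum m).mul_left |b m|
    · simp only [hnorm, tsum_mul_left]
      exact .of_nonneg_of_le (fun m => mul_nonneg (abs_nonneg _) (tsum_nonneg (ha m)))
        (fun m => mul_le_mul_of_nonneg_left ((hsum m).tsum_le_of_sum_le (haC m)) (abs_nonneg _))
        (hb.abs.mul_right C)
  exact hprod.prod_symm.prod.congr fun k => (hc k).tsum_eq

variable {n d : ℕ} {Y : (k : ℕ) → Fin (numHarm n k) → Sph n → ℝ} {κ : (Fin d → ℝ) → ℝ}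
  {b : (Fin d → ℕ) → ℝ}

theorem summable_coeff (hb : ∀ t ∈ cube d, HasSum (fun m => b m * ∏ i, t i ^ m i) (κ t)) :
    Summable b := by
  simpa using (hb 1 (mem_cube.2 fun _ => by simp)).summable

theorem continuousOn_of_hasSum (hb : ∀ t ∈ cube d, HasSum (fun m => b m * ∏ i, t i ^ m i) (κ t)) :
    ContinuousOn κ (cube d) := by
  refine (continuousOn_tsum (u := fun m => |b m|)
    (fun m => (continuous_const.fun_mul (continuous_prod_pow m)).continuousOn)
    (summable_coeff hb).abs fun m t ht => ?_).congr fun t ht => (hb t ht).tsum_eq.symm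
  rw [norm_mul]
  exact mul_le_of_le_one_right (abs_nonneg _) (abs_prod_pow_le_one ht m)

theorem hasSum_eigval (hb : ∀ t ∈ cube d, HasSum (fun m => b m * ∏ i, t i ^ m i) (κ t))
    (k : Fin d → ℕ) :
    HasSum (fun m => b m * eigval n (fun t => ∏ i, t i ^ m i) k) (eigval n κ k) := by
  obtain ⟨B, hB⟩ := (isCompact_cube d).exists_bound_of_continuousOn
    (continuous_gegProd (n := n) k).continuousOn
  have hsB := (summable_coeff hb).abs.mul_right B
  simp only [eigval_eq_integral, ← integral_const_mul, ← mul_assoc]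
  refine hasSum_integral_of_dominated_convergence (fun m _ => |b m| * B) (fun m => ?_) (fun m => ?_)
    (.of_forall fun _ => hsB) (integrable_const _) ?_
  · exact ((continuous_const.mul (continuous_prod_pow m)).mul
      (continuous_gegProd k)).aestronglyMeasurable
  · filter_upwards [ae_mem_cube n d] with t ht
    calc ‖b m * (∏ i, t i ^ m i) * gegProd n k t‖
        = |b m| * |∏ i, t i ^ m i| * ‖gegProd n k t‖ := by rw [norm_mul, norm_mul]; rfl
      _ ≤ |b m| * 1 * B := by
        gcongr
        exacts [abs_prod_pow_le_one ht m, hB t ht]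
      _ = |b m| * B := by rw [mul_one]
  · filter_upwards [ae_mem_cube n d] with t ht
    exact (hb t ht).mul_right _

theorem IsSHBasis.summable_of_hasSum (hn : 2 ≤ n) (hY : IsSHBasis n Y)
    (hb : ∀ t ∈ cube d, HasSum (fun m => b m * ∏ i, t i ^ m i) (κ t)) :
    Summable fun k : Fin d → ℕ => |eigval n κ k| * sumSq n k := by
  obtain ⟨σ⟩ := nonempty_sph (n := n) (by omega)
  have hdiag : dots (fun _ : Fin d => σ) (fun _ => σ) = 1 := by
    ext i
    rw [dots, real_inner_self_eq_norm_sq, norm_eq_of_mem_sphere, one_pow, Pi.one_apply]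
  have hle (m : Fin d → ℕ) (F : Finset (Fin d → ℕ)) :
      ∑ k ∈ F, eigval n (fun t => ∏ i, t i ^ m i) k * sumSq n k ≤ 1 := by
    simpa only [hdiag, Pi.one_apply, one_pow, Finset.prod_const_one] using
      hY.sum_eigval_mul_sumSq_le hn (continuous_prod_pow m).continuousOn
        (posSemidef_prod_pow_dots m) F fun _ => σ
  have hnonneg (m k : Fin d → ℕ) : 0 ≤ eigval n (fun t => ∏ i, t i ^ m i) k * sumSq n k :=
    mul_nonneg (hY.eigval_nonneg hn (continuous_prod_pow m).continuousOn
      (posSemidef_prod_pow_dots m) k) (hY.sumSq_pos hn k).le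
  have hsum := summable_of_hasSum_mul (summable_coeff hb) hnonneg hle fun k => by
    simpa only [mul_assoc] using (hasSum_eigval (n := n) hb k).mul_right (sumSq n k)
  simpa only [abs_mul, abs_of_pos (hY.sumSq_pos hn _)] using hsum.abs

end PowerSeries

end MultiDot

end

open MultiDot in
theorem mainTheorem5 (ζ d : ℕ) (hζ : 2 ≤ ζ)
    (Y : (k : ℕ) → Fin (numHarm ζ k) → Sph ζ → ℝ) (hY : IsSHBasis ζ Y)
    (K : MS ζ d → MS ζ d → ℝ) (κ : (Fin d → ℝ) → ℝ) (hK : IsMultiDot K κ)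
    (hκ : MeasureTheory.IntegrableOn (fun t => κ t * ∏ i, weight ζ (t i)) (cube d)) :
    -- the `Q_k` are the orthogonal polynomials for the weight, with `deg Q_k = k`, `Q_k(1) = 1`
    (∀ k, (gegenbauer ζ k).natDegree = k ∧ (gegenbauer ζ k).eval 1 = 1) ∧
    (∀ k l, MeasureTheory.IntegrableOn
        (fun t => (gegenbauer ζ k).eval t * (gegenbauer ζ l).eval t * weight ζ t)
        (Set.Icc (-1) 1) ∧
      (k ≠ l → ∫ t in Set.Icc (-1 : ℝ) 1,
        (gegenbauer ζ k).eval t * (gegenbauer ζ l).eval t * weight ζ t = 0)) ∧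
    -- the SH-products are a complete orthonormal system of `L²` of the multisphere
    (∀ p q : SHIndex ζ d, ∫ x, shProd Y p x * shProd Y q x ∂(unif ζ d) =
      open Classical in if p = q then 1 else 0) ∧
    (∀ f : MS ζ d → ℝ, MeasureTheory.MemLp f 2 (unif ζ d) →
      (∀ p : SHIndex ζ d, ∫ x, f x * shProd Y p x ∂(unif ζ d) = 0) →
      f =ᵐ[unif ζ d] 0) ∧
    -- they are eigenfunctions of the kernel, with eigenvalues depending only on the frequencies
    (∀ p : SHIndex ζ d, IsEigenfunction K (eigval ζ κ p.1) (shProd Y p)) ∧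
    -- there are no other eigenvalues, and every eigenfunction is in the closed span of the
    -- SH-products with the same eigenvalue
    (∀ (μ : ℝ) (f : MS ζ d → ℝ), MeasureTheory.MemLp f 2 (unif ζ d) → ¬ f =ᵐ[unif ζ d] 0 →
      (∀ᵐ x ∂(unif ζ d), ∫ z, K x z * f z ∂(unif ζ d) = μ * f x) →
      (∃ k : Fin d → ℕ, μ = eigval ζ κ k) ∧
      ∀ p : SHIndex ζ d, eigval ζ κ p.1 ≠ μ → ∫ x, f x * shProd Y p x ∂(unif ζ d) = 0) ∧
    -- Mercer's decomposition, in `L²`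
    (MeasureTheory.IntegrableOn (fun t => κ t ^ 2 * ∏ i, weight ζ (t i)) (cube d) →
      MeasureTheory.MemLp (fun w : MS ζ d × MS ζ d => K w.1 w.2) 2
        ((unif ζ d).prod (unif ζ d)) ∧
      Filter.Tendsto
        (fun s : Finset (SHIndex ζ d) => MeasureTheory.eLpNorm
          (fun w : MS ζ d × MS ζ d => K w.1 w.2 -
            ∑ p ∈ s, eigval ζ κ p.1 * shProd Y p w.1 * shProd Y p w.2) 2
          ((unif ζ d).prod (unif ζ d)))
        Filter.atTop (nhds 0)) ∧
    -- Mercer's decomposition, uniformly and hence pointwise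
    ((ContinuousOn κ (cube d) ∧ (Matrix.of K).PosSemidef) ∨ IsPowerSeriesOnCube κ →
      TendstoUniformly
        (fun (s : Finset (SHIndex ζ d)) (w : MS ζ d × MS ζ d) =>
          ∑ p ∈ s, eigval ζ κ p.1 * shProd Y p w.1 * shProd Y p w.2)
        (fun w => K w.1 w.2) Filter.atTop) := by
  obtain rfl : K = fun x z => κ (dots x z) := funext fun x => funext (hK x)
  have hκ' : Integrable κ (dotsMeasure ζ d) := (integrable_dotsMeasure_iff hζ).2 hκ
  refine ⟨fun k => ⟨natDegree_gegenbauer hζ k, eval_one_gegenbauer hζ k⟩,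
    fun k l => ⟨integrableOn_gegenbauer_mul_gegenbauer_mul_weight hζ k l,
      setIntegral_gegenbauer_mul_gegenbauer_mul_weight hζ⟩,
    hY.integral_shProd_mul hζ, fun f hf => hY.ae_eq_zero hζ hf,
    hY.isEigenfunction_shProd hζ hκ',
    fun μ f hf hf0 hμ => ⟨hY.exists_eq_eigval hζ hκ' hf hf0 hμ,
      fun p => hY.integral_mul_shProd_eq_zero hζ hκ' (hf.integrable one_le_two) hμ⟩,
    fun hκ_sq => ?_, ?_⟩
  · have hκ_sq' : Integrable (fun t => κ t ^ 2) (dotsMeasure ζ d) :=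
      (integrable_dotsMeasure_iff hζ).2 hκ_sq
    exact ⟨memLp_prod_comp_dots hζ hκ'.aestronglyMeasurable hκ_sq',
      hY.tendsto_eLpNorm_sub_sum hζ hκ' hκ_sq'⟩
  · rintro (⟨hcont, hpsd⟩ | ⟨b, hb⟩)
    · exact hY.tendstoUniformly hζ hcont (hY.summable_of_posSemidef hζ hcont hpsd)
    · exact hY.tendstoUniformly hζ (continuousOn_of_hasSum hb) (hY.summable_of_hasSum hζ hb)
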